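/- Let $V$ be a commutative valuation domain of arbitrary rank with field of fractions $F$, let $K/F$ be a finite Galois extension with group $G$, and let $S$ be the integral closure of $V$ in $K$. Let $J(R)$ denote the Jacobson radical of a ring $R$, $U(R)$ its group of units, and $\overline{R}=R/J(R)$. Let $f:G\times G\to S\setminus\{0\}$ be a normalized two-cocycle, i.e. $f(1,\sigma)=f(\sigma,1)=1$ and $\sigma(f(\tau,\gamma))\,f(\sigma,\tau\gamma)=f(\sigma,\tau)\,f(\sigma\tau,\gamma)$ for all $\sigma,\tau,\gamma\in G$; its values need not be units of $S$. Let $A_f=\bigoplus_{\sigma\in G}Sx_\sigma$ be the crossed-product order with multiplication $(sx_\sigma)(tx_\tau)=s\,\sigma(t)\,f(\sigma,\tau)\,x_{\sigma\tau}$. Let $H=\{\sigma\in G: f(\sigma,\sigma^{-1})\in U(S)\}$, a subgroup of $G$, and let $\mathrm{Gr}(f)$ be the partial order on the left coset space $G/H$ defined by $\sigma H\le\tau H$ if and only if $f(\sigma,\sigma^{-1}\tau)\in U(S)$. A ring is called semihereditary if all its finitely generated left ideals and all its finitely generated right ideals are projective. For a maximal ideal $M$ of $S$ let $e=[\Gamma_{S_M}:\Gamma_V]$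 be the index of the value groups ($\Gamma_V=F^\times/U(V)$, $\Gamma_{S_M}=K^\times/U(S_M)$), and let $r$ be the number of maximal ideals of $S$. Assume that - $K/F$ is tamely ramified: $\operatorname{char}\overline{V}$ does not divide $e$, and $\overline{S_M}$ is separable over $\overline{V}$, for every maximal ideal $M$ of $S$; - $K/F$ is defectless: $[K:F]=e\,[\overline{S_M}:\overline{V}]\,r$ for every maximal ideal $M$ of $S$; - $J(V)$ is a principal ideal of $V$; - $V$ is indecomposed in $K$: exactly one valuation ring of $K$ lies over $V$. Then the following are equivalent: 1. $A_f$ is semihereditary. 2. $f(\sigma,\tau)\notin J(S)^2$ for all $\sigma,\tau\in G$. 3. $H$ is a normal subgroup of $G$ and $G/H$ is cyclic; further, either $H=G$, or there exists $\sigma\in G$ such that $G/H=\langle\sigma H\rangle$, the graph $\mathrm{Gr}(f)$ is the chain $H\le\sigma H\le\sigma^2H\le\cdots\le\sigma^{|G/H|-1}H$, and $J(A_f)=x_\sigma A_f$. -/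

import Mathlib

/-- `R` is semihereditary: every finitely generated left ideal and every finitely generated right
ideal of `R` is a projective `R`-module. Right ideals are submodules of `R` as an
`Rᵐᵒᵖ`-module. -/
def IsSemihereditary (R : Type*) [Ring R] : Prop :=
  (∀ I : Submodule R R, I.FG → Module.Projective R I) ∧
    ∀ I : Submodule Rᵐᵒᵖ R, I.FG → Module.Projective Rᵐᵒᵖ I

/-! ### Valuation theory of the integral closure -/

section Valuation

/-- For a subring `R` of a field `L` (given by an algebra structure), the group `Γ_R = Lˣ / Rˣ`,
which is the value group of `R` when `R` is a valuation ring of `L`. -/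
abbrev ValGroup (R L : Type*) [CommRing R] [Field L] [Algebra R L] : Type _ :=
  Lˣ ⧸ (Units.map (algebraMap R L).toMonoidHom).range

/-- The canonical map `Γ_V → Γ_R` induced by the inclusion `F ⊆ K`, where `V → R` is a map of
subrings of `F` and `K`. -/
def ValGroup.map (V F R K : Type*) [CommRing V] [Field F] [CommRing R] [Field K]
    [Algebra V F] [Algebra R K] [Algebra F K] [Algebra V R] [Algebra V K]
    [IsScalarTower V F K] [IsScalarTower V R K] : ValGroup V F →* ValGroup R K :=
  QuotientGroup.map _ _ (Units.map (algebraMap F K).toMonoidHom) <| by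
    rintro _ ⟨u, rfl⟩
    refine ⟨Units.map (algebraMap V R).toMonoidHom u, ?_⟩
    ext
    simp only [RingHom.toMonoidHom_eq_coe, Units.coe_map, MonoidHom.coe_coe]
    rw [← IsScalarTower.algebraMap_apply, ← IsScalarTower.algebraMap_apply]

/-- The ramification index `[Γ_R : Γ_V]`. -/
noncomputable def ramIndex (V F R K : Type*) [CommRing V] [Field F] [CommRing R] [Field K]
    [Algebra V F] [Algebra R K] [Algebra F K] [Algebra V R] [Algebra V K]
    [IsScalarTower V F K] [IsScalarTower V R K] : ℕ :=
  (ValGroup.map V F R K).range.index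

variable {V K : Type*} [CommRing V] [Field K] [Algebra V K]

theorem coe_ne_zero_of_notMem {M : Ideal (integralClosure V K)} {s : integralClosure V K}
    (hs : s ∉ M) : (s : K) ≠ 0 := fun h =>
  hs ((Subtype.ext h : s = 0) ▸ M.zero_mem)

/-- The localization `S_M` of `S = integralClosure V K` at a prime `M`, as a subring of `K`. -/
def locAt (M : Ideal (integralClosure V K)) [hM : M.IsPrime] : Subalgebra V K where
  carrier := {x | ∃ a s : integralClosure V K, s ∉ M ∧ x = (a : K) / (s : K)}
  mul_mem' := by
    rintro _ _ ⟨a, s, hs, rfl⟩ ⟨b, t, ht, rfl⟩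
    refine ⟨a * b, s * t, fun h => (hM.mem_or_mem h).elim hs ht, ?_⟩
    push_cast
    rw [div_mul_div_comm]
  add_mem' := by
    rintro _ _ ⟨a, s, hs, rfl⟩ ⟨b, t, ht, rfl⟩
    refine ⟨a * t + s * b, s * t, fun h => (hM.mem_or_mem h).elim hs ht, ?_⟩
    have h1 := coe_ne_zero_of_notMem hs
    have h2 := coe_ne_zero_of_notMem ht
    push_cast
    rw [div_add_div _ _ h1 h2]
  algebraMap_mem' r :=
    ⟨algebraMap V _ r, 1, fun h => hM.ne_top (M.eq_top_iff_one.mpr h), by simp⟩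

instance locAt.isLocalRing (M : Ideal (integralClosure V K)) [hM : M.IsPrime] :
    IsLocalRing (locAt M) := by
  refine IsLocalRing.of_isUnit_or_isUnit_one_sub_self ?_
  have key : ∀ (a s : integralClosure V K) (x : locAt M), s ∉ M → a ∉ M →
      (x : K) = (a : K) / (s : K) → IsUnit x := by
    intro a s x hs ha hx
    refine IsUnit.of_mul_eq_one ⟨(s : K) / (a : K), s, a, ha, rfl⟩ (Subtype.ext ?_)
    have h1 := coe_ne_zero_of_notMem hs
    have h2 := coe_ne_zero_of_notMem ha
    change (x : K) * ((s : K) / (a : K)) = 1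
    rw [hx]
    field_simp
  rintro ⟨x, a, s, hs, hx⟩
  by_cases ha : a ∈ M
  · right
    refine key (s - a) s _ hs (fun h => hs ?_) ?_
    · simpa using M.add_mem h ha
    · have h1 := coe_ne_zero_of_notMem hs
      change (1 : K) - x = _
      rw [hx]
      push_cast
      field_simp
  · exact Or.inl (key a s _ hs ha hx)

instance locAt.isLocalHom [IsLocalRing V] (M : Ideal (integralClosure V K)) [hM : M.IsMaximal] :
    IsLocalHom (algebraMap V (locAt M)) := by
  refine ⟨fun v hv => ?_⟩
  by_contra hnu
  obtain ⟨⟨y, a, s, hs, rfl⟩, hy⟩ := hv.exists_right_inv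
  have hy' : algebraMap V K v * ((a : K) / (s : K)) = 1 := congrArg Subtype.val hy
  have h1 := coe_ne_zero_of_notMem hs
  have h2 : s = algebraMap V (integralClosure V K) v * a := by
    apply Subtype.ext
    change (s : K) = algebraMap V K v * (a : K)
    field_simp at hy'
    exact hy'.symm
  have h3 := Ideal.isMaximal_comap_of_isIntegral_of_isMaximal (R := V) M
  have h4 : v ∈ Ideal.comap (algebraMap V (integralClosure V K)) M := by
    rw [IsLocalRing.eq_maximalIdeal h3]
    exact (IsLocalRing.mem_maximalIdeal v).mpr hnu
  exact hs (h2 ▸ M.mul_mem_right a h4)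

variable (V F K : Type*) [CommRing V] [IsLocalRing V] [Field F] [Field K] [Algebra V F]
  [Algebra F K] [Algebra V K] [IsScalarTower V F K]

/-- `K/F` is defectless with respect to `V`: `[K : F] = e f r`, where `e` and `f` are the
ramification index and the residue degree at a maximal ideal `M` of the integral closure `S` of
`V` in `K`, and `r` is the number of maximal ideals of `S`. -/
def IsDefectless : Prop :=
  ∀ (M : Ideal (integralClosure V K)) [M.IsMaximal],
    Module.finrank F K =
      ramIndex V F (locAt M) K *
        Module.finrank (IsLocalRing.ResidueField V) (IsLocalRing.ResidueField (locAt M)) *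
        Nat.card (MaximalSpectrum (integralClosure V K))

/-- `K/F` is tamely ramified with respect to `V`: the characteristic of the residue field of `V`
does not divide the ramification index, and the residue field extension is separable. -/
def IsTamelyRamified : Prop :=
  ∀ (M : Ideal (integralClosure V K)) [M.IsMaximal],
    ¬ ringChar (IsLocalRing.ResidueField V) ∣ ramIndex V F (locAt M) K ∧
      Algebra.IsSeparable (IsLocalRing.ResidueField V) (IsLocalRing.ResidueField (locAt M))

/-- `V` is indecomposed in `K`: there is exactly one valuation ring of `K` lying over `V`. -/
def IsIndecomposed : Prop :=
  ∃! W : ValuationSubring K,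
    W.toSubring.comap (algebraMap F K) = (algebraMap V F).range

end Valuation

/-! ### Crossed products -/

/-- A normalized two-cocycle of `G` with values in the nonzero elements of the commutative ring
`R`; the values need not be units of `R`. -/
structure NormalizedCocycle (G R : Type*) [Group G] [CommRing R] [MulSemiringAction G R] where
  toFun : G → G → R
  ne_zero' : ∀ σ τ, toFun σ τ ≠ 0
  one_left' : ∀ σ, toFun 1 σ = 1
  one_right' : ∀ σ, toFun σ 1 = 1
  cocycle' : ∀ σ τ γ,
    σ • toFun τ γ * toFun σ (τ * γ) = toFun σ τ * toFun (σ * τ) γ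

namespace NormalizedCocycle

variable {G R : Type*} [Group G] [CommRing R] [MulSemiringAction G R]

instance : CoeFun (NormalizedCocycle G R) (fun _ => G → G → R) := ⟨toFun⟩

variable (f : NormalizedCocycle G R)

theorem one_left (σ : G) : f 1 σ = 1 := f.one_left' σ

theorem one_right (σ : G) : f σ 1 = 1 := f.one_right' σ

theorem cocycle (σ τ γ : G) : σ • f τ γ * f σ (τ * γ) = f σ τ * f (σ * τ) γ :=
  f.cocycle' σ τ γ

theorem isUnit_pair {τ : G} (h : IsUnit (f τ τ⁻¹)) (σ : G) :
    IsUnit (f σ τ) ∧ IsUnit (f (σ * τ) τ⁻¹) := by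
  have h1 := f.cocycle σ τ τ⁻¹
  rw [mul_inv_cancel, one_right, mul_one] at h1
  have h2 : IsUnit (f σ τ * f (σ * τ) τ⁻¹) :=
    h1 ▸ h.map (MulSemiringAction.toRingHom G R σ)
  exact isUnit_of_mul_isUnit_left h2 |>.elim fun u hu =>
    ⟨⟨u, hu⟩, isUnit_of_mul_isUnit_right h2⟩

/-- The subgroup `H = {σ ∈ G | f(σ, σ⁻¹) ∈ U(R)}`. -/
def unitSubgroup : Subgroup G where
  carrier := {σ | IsUnit (f σ σ⁻¹)}
  one_mem' := by simp [one_left]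
  mul_mem' := by
    intro σ τ hσ hτ
    have h1 := f.cocycle (σ * τ) τ⁻¹ σ⁻¹
    rw [mul_inv_cancel_right, ← mul_inv_rev] at h1
    have h2 : IsUnit (f (σ * τ) τ⁻¹ * f σ σ⁻¹) := (f.isUnit_pair hτ σ).2.mul hσ
    rw [← h1] at h2
    exact isUnit_of_mul_isUnit_right h2
  inv_mem' := by
    intro σ hσ
    have h1 := f.cocycle σ σ⁻¹ σ
    rw [inv_mul_cancel, mul_inv_cancel, one_right, one_left, mul_one, mul_one] at h1
    have h2 : f σ⁻¹ σ = σ⁻¹ • f σ σ⁻¹ := by rw [← h1, inv_smul_smul]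
    change IsUnit (f σ⁻¹ σ⁻¹⁻¹)
    rw [inv_inv, h2]
    exact IsUnit.map (MulSemiringAction.toRingHom G R σ⁻¹) hσ

theorem mem_unitSubgroup {σ : G} : σ ∈ f.unitSubgroup ↔ IsUnit (f σ σ⁻¹) := Iff.rfl

theorem isUnit_of_mem_right {h : G} (hh : h ∈ f.unitSubgroup) (σ : G) : IsUnit (f σ h) :=
  (f.isUnit_pair hh σ).1

theorem isUnit_of_mem_left {h : G} (hh : h ∈ f.unitSubgroup) (σ : G) : IsUnit (f h σ) := by
  have h1 := f.cocycle h h⁻¹ (h * σ)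
  rw [inv_mul_cancel_left, mul_inv_cancel, one_left, mul_one] at h1
  have h2 : IsUnit (h • f h⁻¹ (h * σ) * f h σ) := h1 ▸ hh
  exact isUnit_of_mul_isUnit_right h2

/-- Transitivity of the graph relation, on representatives. -/
theorem isUnit_trans {σ τ γ : G} (h1 : IsUnit (f σ (σ⁻¹ * τ))) (h2 : IsUnit (f τ (τ⁻¹ * γ))) :
    IsUnit (f σ (σ⁻¹ * γ)) := by
  have h := f.cocycle σ (σ⁻¹ * τ) (τ⁻¹ * γ)
  rw [mul_inv_cancel_left, show σ⁻¹ * τ * (τ⁻¹ * γ) = σ⁻¹ * γ by group] at h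
  have h3 := h1.mul h2
  rw [← h] at h3
  exact isUnit_of_mul_isUnit_right h3

theorem isUnit_of_inv_mul_mem {σ τ : G} (h : σ⁻¹ * τ ∈ f.unitSubgroup) :
    IsUnit (f σ (σ⁻¹ * τ)) := f.isUnit_of_mem_right h σ

/-- The relation `σH ≤ τH ↔ f(σ, σ⁻¹τ) ∈ U(R)` on the left coset space `G/H`. -/
def graphLE : G ⧸ f.unitSubgroup → G ⧸ f.unitSubgroup → Prop :=
  Quotient.lift₂ (fun σ τ => IsUnit (f σ (σ⁻¹ * τ))) <| by
    intro a b a' b' ha hb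
    have ha : a⁻¹ * a' ∈ f.unitSubgroup := QuotientGroup.leftRel_apply.mp ha
    have hb : b⁻¹ * b' ∈ f.unitSubgroup := QuotientGroup.leftRel_apply.mp hb
    have ha' : a'⁻¹ * a ∈ f.unitSubgroup := by simpa using inv_mem ha
    have hb' : b'⁻¹ * b ∈ f.unitSubgroup := by simpa using inv_mem hb
    refine propext ⟨fun h => ?_, fun h => ?_⟩
    · exact f.isUnit_trans (f.isUnit_of_inv_mul_mem ha')
        (f.isUnit_trans h (f.isUnit_of_inv_mul_mem hb))
    · exact f.isUnit_trans (f.isUnit_of_inv_mul_mem ha)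
        (f.isUnit_trans h (f.isUnit_of_inv_mul_mem hb'))

theorem graphLE_mk (σ τ : G) :
    f.graphLE (σ : G ⧸ f.unitSubgroup) (τ : G ⧸ f.unitSubgroup) ↔ IsUnit (f σ (σ⁻¹ * τ)) :=
  Iff.rfl

/-- The graph `Gr(f)` of `f`: the partial order `graphLE` on `G/H`. -/
instance graph : PartialOrder (G ⧸ f.unitSubgroup) where
  le := f.graphLE
  le_refl := by
    intro a
    induction a using QuotientGroup.induction_on with | H σ => ?_
    rw [graphLE_mk, inv_mul_cancel, one_right]
    exact isUnit_one
  le_trans := by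
    intro a b c
    induction a using QuotientGroup.induction_on with | H σ => ?_
    induction b using QuotientGroup.induction_on with | H τ => ?_
    induction c using QuotientGroup.induction_on with | H γ => ?_
    exact f.isUnit_trans
  le_antisymm := by
    intro a b
    induction a using QuotientGroup.induction_on with | H σ => ?_
    induction b using QuotientGroup.induction_on with | H τ => ?_
    intro h1 h2
    rw [graphLE_mk] at h1 h2
    refine QuotientGroup.eq.mpr ?_
    have h := f.cocycle σ (σ⁻¹ * τ) (τ⁻¹ * σ)
    rw [mul_inv_cancel_left, show σ⁻¹ * τ * (τ⁻¹ * σ) = 1 by group, one_right, mul_one] at h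
    have h3 := h1.mul h2
    rw [← h] at h3
    have h4 : IsUnit (f (σ⁻¹ * τ) (τ⁻¹ * σ)) := by
      have := h3.map (MulSemiringAction.toRingHom G R σ⁻¹)
      simpa using this
    rw [mem_unitSubgroup, show (σ⁻¹ * τ)⁻¹ = τ⁻¹ * σ by group]
    exact h4

theorem graph_le_iff (σ τ : G) :
    (σ : G ⧸ f.unitSubgroup) ≤ (τ : G ⧸ f.unitSubgroup) ↔ IsUnit (f σ (σ⁻¹ * τ)) :=
  Iff.rfl

/-- The underlying additive group of the crossed product `A_f = ∑_{σ ∈ G} R x_σ` for a finite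
group `G`: the function `a` stands for `∑ σ, a σ x_σ`. -/
def CrossedProduct {G R : Type*} [Group G] [CommRing R] [MulSemiringAction G R]
    (_f : NormalizedCocycle G R) : Type _ := G → R

namespace CrossedProduct

variable {f}

instance : AddCommGroup f.CrossedProduct := inferInstanceAs (AddCommGroup (G → R))

@[ext] theorem ext {a b : f.CrossedProduct} (h : ∀ σ, a σ = b σ) : a = b := funext h

theorem add_apply (a b : f.CrossedProduct) (σ : G) : (a + b) σ = a σ + b σ := rfl

theorem zero_apply (σ : G) : (0 : f.CrossedProduct) σ = 0 := rfl

variable (f) in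
/-- The element `r x_σ`. -/
def single [DecidableEq G] (σ : G) (r : R) : f.CrossedProduct :=
  fun τ => if τ = σ then r else 0

variable (f) in
/-- The basis element `x_σ`. -/
def x [DecidableEq G] (σ : G) : f.CrossedProduct := single f σ 1

instance [DecidableEq G] : One f.CrossedProduct := ⟨x f 1⟩

theorem one_apply [DecidableEq G] (τ : G) :
    (1 : f.CrossedProduct) τ = if τ = 1 then 1 else 0 := rfl

variable [Fintype G]

/-- The multiplication determined by `(r x_σ) (s x_τ) = r σ(s) f(σ, τ) x_{στ}`. -/
instance : Mul f.CrossedProduct :=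
  ⟨fun a b γ => ∑ σ, a σ * σ • b (σ⁻¹ * γ) * f σ (σ⁻¹ * γ)⟩

theorem mul_apply (a b : f.CrossedProduct) (γ : G) :
    (a * b) γ = ∑ σ, a σ * σ • b (σ⁻¹ * γ) * f σ (σ⁻¹ * γ) := rfl

theorem mul_assoc' (a b c : f.CrossedProduct) : a * b * c = a * (b * c) := by
  ext γ
  simp only [mul_apply, Finset.sum_mul, Finset.smul_sum, Finset.mul_sum]
  rw [Finset.sum_comm]
  refine Finset.sum_congr rfl fun σ _ => ?_
  refine Fintype.sum_equiv (Equiv.mulLeft σ⁻¹) _ _ fun ρ => ?_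
  have h := f.cocycle σ (σ⁻¹ * ρ) (ρ⁻¹ * γ)
  rw [mul_inv_cancel_left, show σ⁻¹ * ρ * (ρ⁻¹ * γ) = σ⁻¹ * γ by group] at h
  simp only [Equiv.coe_mulLeft, smul_mul', smul_smul, mul_inv_cancel_left, mul_inv_rev, inv_inv,
    show ρ⁻¹ * σ * (σ⁻¹ * γ) = ρ⁻¹ * γ by group]
  linear_combination (-(a σ * σ • b (σ⁻¹ * ρ) * ρ • c (ρ⁻¹ * γ))) * h

instance [DecidableEq G] : Ring f.CrossedProduct where
  __ := (inferInstance : AddCommGroup f.CrossedProduct)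
  mul := (· * ·)
  one := 1
  mul_assoc := mul_assoc'
  one_mul a := by
    ext γ
    rw [mul_apply, Finset.sum_eq_single 1]
    · simp [one_apply, one_left]
    · intro σ _ hσ
      simp [one_apply, hσ]
    · simp
  mul_one a := by
    ext γ
    rw [mul_apply, Finset.sum_eq_single γ]
    · simp [one_apply, one_right]
    · intro σ _ hσ
      have : σ⁻¹ * γ ≠ 1 := fun h => hσ (inv_mul_eq_one.mp h)
      simp [one_apply, this]
    · simp
  left_distrib a b c := by
    ext γ
    simp [mul_apply, add_apply, mul_add, add_mul, Finset.sum_add_distrib]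
  right_distrib a b c := by
    ext γ
    simp [mul_apply, add_apply, add_mul, Finset.sum_add_distrib]
  zero_mul a := by
    ext γ
    simp [mul_apply, zero_apply]
  mul_zero a := by
    ext γ
    simp [mul_apply, zero_apply]

theorem single_mul_single [DecidableEq G] (σ τ : G) (r s : R) :
    single f σ r * single f τ s = single f (σ * τ) (r * σ • s * f σ τ) := by
  ext γ
  rw [mul_apply, Finset.sum_eq_single σ]
  · by_cases h : γ = σ * τ
    · subst h; simp [single]
    · have h' : σ⁻¹ * γ ≠ τ := fun e => h (by rw [← e, mul_inv_cancel_left])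
      simp [single, h, h']
  · intro ρ _ hρ
    simp [single, hρ]
  · simp

end CrossedProduct

end NormalizedCocycle

/-! Write M = J(S) = (ϖ) and A = A_f. The hypotheses on K/F serve to give three facts about S.
First, S is a valuation ring: the unique W over V is stable under G, so its elements are roots of
characteristic polynomials over V (`IsIndecomposed.valuationRing`). Second, M is principal, by
comparing elements of M with their norms in V (`exists_maximalIdeal_eq_span_of_isInvariant`). Third,
some c in S has trace 1, because the inertia group has order e, a unit in the residue field
(`exists_sum_smul_eq_one`). The equivalence `tfae_isSemihereditary` uses nothing else.

2 ⇒ 3: values outside M² are units or associates of ϖ, so their valuations form a cocycle with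
values 0 and 1. Its row sums give a homomorphism from G to the integers modulo |G| with kernel H,
and an element outside H with least row sum generates G/H (`exists_generator_of_binaryCocycle`). For
this σ, both x_σ A and A x_σ consist of the elements whose coefficients on H lie in M. A Maschke
argument over H, using c, makes A / x_σ A semisimple, while a power of x_σ lies in M; hence J(A) =
x_σ A.

2 ⇒ 1: every finitely generated torsion-free A-module N is projective
(`projective_of_forall_notMem_sq`). A surjection from a free module P onto N splits over S, and
averaging makes the section A-linear at the cost of a central factor z. To divide by z, P is first
replaced by a submodule Q that still maps onto N and meets the kernel only inside zP; it is found by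
splitting repeatedly modulo x_σ. Right ideals are left modules over the crossed product of the
opposite cocycle.

1 ⇒ 2: the left ideal of elements with coefficients on H in M is finitely generated. If it is
projective, expanding ϖ in a dual basis yields some ρ with f(ρ, ρ⁻¹) in M but not in M², and with
enough units around it to control all other values.

3 ⇒ 2: since M lies in x_σ A, the value f(σ, σ⁻¹) generates M; the chain makes every f(τ, τ⁻¹) with
τ outside H an associate of a conjugate of it, up to units. -/

/-! ### Two-cocycles with values in `{0, 1}` -/

section BinaryCocycle

variable {G : Type*} [Group G] [Fintype G] {w : G → G → ℕ}

/-- Summing the cocycle identity over the last variable: `w` is, up to the factor `|G|`, the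
coboundary of the row sums. -/
theorem card_mul_eq_rowSum
    (hc : ∀ σ τ γ, w τ γ + w σ (τ * γ) = w σ τ + w (σ * τ) γ) (σ τ : G) :
    Fintype.card G * w σ τ + ∑ γ, w (σ * τ) γ = (∑ γ, w σ γ) + ∑ γ, w τ γ := by
  have h := Finset.sum_congr (rfl : (Finset.univ : Finset G) = _) fun γ _ => hc σ τ γ
  rw [Finset.sum_add_distrib, Finset.sum_add_distrib, Finset.sum_const, Finset.card_univ,
    smul_eq_mul, Fintype.sum_equiv (Equiv.mulLeft τ) (fun γ => w σ (τ * γ)) (fun γ => w σ γ)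
      fun _ => rfl] at h
  omega

/-- The entry at the identity vanishes. The strict bound makes a row sum determined by its residue
modulo |G|. -/
theorem rowSum_lt_card (hw : ∀ σ τ, w σ τ ≤ 1) (h1 : ∀ σ, w σ 1 = 0) (σ : G) :
    ∑ γ, w σ γ < Fintype.card G := by
  calc ∑ γ, w σ γ < ∑ _γ : G, 1 :=
        Finset.sum_lt_sum (fun γ _ => hw σ γ) ⟨1, Finset.mem_univ _, by simp [h1]⟩
    _ = Fintype.card G := by simp

/-- A `{0, 1}`-valued normalized cocycle whose kernel `H` is proper is the carry cocycle of a
cyclic quotient `G/H`. -/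
theorem exists_generator_of_binaryCocycle (hw : ∀ σ τ, w σ τ ≤ 1) (h1 : ∀ σ, w σ 1 = 0)
    (hc : ∀ σ τ γ, w τ γ + w σ (τ * γ) = w σ τ + w (σ * τ) γ) (H : Subgroup G)
    (hH : ∀ σ, σ ∈ H ↔ w σ σ⁻¹ = 0) (hne : H ≠ ⊤) :
    H.Normal ∧ ∃ σ, σ ∉ H ∧
      (∀ ρ, ρ ∉ H → w σ (σ⁻¹ * ρ) = 0 ∧ w (ρ * σ⁻¹) σ = 0) ∧
      (∀ ρ, ρ ∈ H → w σ (σ⁻¹ * ρ) = 1 ∧ w (ρ * σ⁻¹) σ = 1) ∧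
      (∀ τ, ∃ i : ℕ, (σ ^ i)⁻¹ * τ ∈ H) ∧
      ∀ m : ℕ, (∀ k, 0 < k → k < m → σ ^ k ∉ H) → ∀ i < m, ∀ j < m,
        (w (σ ^ i) ((σ ^ i)⁻¹ * σ ^ j) = 0 ↔ i ≤ j) := by
  set n := Fintype.card G with hn
  set g : G → ℕ := fun σ => ∑ γ, w σ γ with hg
  have key : ∀ σ τ, n * w σ τ + g (σ * τ) = g σ + g τ := card_mul_eq_rowSum hc
  have hlt : ∀ σ, g σ < n := rowSum_lt_card hw h1
  have g1 : g 1 = 0 := by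
    have := key 1 1
    rw [h1] at this
    simpa using this
  have cases01 : ∀ σ τ, w σ τ = 0 ∧ g (σ * τ) = g σ + g τ ∨
      w σ τ = 1 ∧ n + g (σ * τ) = g σ + g τ := by
    intro σ τ
    have h := key σ τ
    rcases Nat.le_one_iff_eq_zero_or_eq_one.mp (hw σ τ) with h0 | h0 <;> rw [h0] at h
    · left; exact ⟨h0, by omega⟩
    · right; exact ⟨h0, by omega⟩
  have hHg : ∀ σ, σ ∈ H ↔ g σ = 0 := by
    intro σ
    rw [hH]
    have h := cases01 σ σ⁻¹
    rw [mul_inv_cancel, g1] at h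
    have := hlt σ
    have := hlt σ⁻¹
    omega
  refine ⟨⟨fun h hh τ => ?_⟩, ?_⟩
  · rw [hHg] at hh ⊢
    -- Modulo n the function g is additive, so g(τhτ⁻¹) is congruent to g(h) = 0; the bound g < n
    -- turns the congruence into equality.
    have a1 := cases01 τ h
    have a2 := cases01 (τ * h) τ⁻¹
    have a3 := cases01 τ τ⁻¹
    rw [mul_inv_cancel, g1] at a3
    have := hlt (τ * h * τ⁻¹)
    have := hlt (τ * h)
    have := hlt τ
    have := hlt τ⁻¹
    omega
  obtain ⟨σ₀, hσ₀⟩ : ∃ σ, σ ∉ H := by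
    by_contra! hcon
    exact hne (eq_top_iff.mpr fun x _ => hcon x)
  obtain ⟨σ, hσ, hmin⟩ := WellFounded.has_min (measure g).wf {σ | σ ∉ H} ⟨σ₀, hσ₀⟩
  have hσ' : σ ∉ H := hσ
  have hmin' : ∀ ρ, ρ ∉ H → g σ ≤ g ρ := fun ρ hρ => not_lt.mp (hmin ρ hρ)
  have hpos : 0 < g σ := Nat.pos_of_ne_zero fun h => hσ' ((hHg σ).mpr h)
  have left : ∀ ρ, w σ (σ⁻¹ * ρ) = 0 ∧ g ρ = g σ + g (σ⁻¹ * ρ) ∨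
      w σ (σ⁻¹ * ρ) = 1 ∧ n + g ρ = g σ + g (σ⁻¹ * ρ) := by
    intro ρ
    have := cases01 σ (σ⁻¹ * ρ)
    rwa [mul_inv_cancel_left] at this
  have right : ∀ ρ, w (ρ * σ⁻¹) σ = 0 ∧ g ρ = g (ρ * σ⁻¹) + g σ ∨
      w (ρ * σ⁻¹) σ = 1 ∧ n + g ρ = g (ρ * σ⁻¹) + g σ := by
    intro ρ
    have := cases01 (ρ * σ⁻¹) σ
    rwa [inv_mul_cancel_right] at this
  -- A carry would give g ρ < g σ, because the other summand is below n; this contradicts the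
  -- minimality of g σ.
  have hout : ∀ ρ, ρ ∉ H → w σ (σ⁻¹ * ρ) = 0 ∧ w (ρ * σ⁻¹) σ = 0 := by
    intro ρ hρ
    have := hmin' ρ hρ
    have := left ρ
    have := right ρ
    have := hlt (σ⁻¹ * ρ)
    have := hlt (ρ * σ⁻¹)
    omega
  refine ⟨σ, hσ', hout, ?_, ?_, ?_⟩
  · intro ρ hρ
    rw [hHg] at hρ
    have := left ρ
    have := right ρ
    omega
  · intro τ
    -- Removing a left factor σ lowers g by g σ > 0, so the descent ends in H.
    induction hk : g τ using Nat.strong_induction_on generalizing τ with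
    | _ k ih =>
      by_cases hτ : τ ∈ H
      · exact ⟨0, by simpa using hτ⟩
      · have e1 := hout τ hτ
        have e2 := left τ
        obtain ⟨i, hi⟩ := ih (g (σ⁻¹ * τ)) (by omega) (σ⁻¹ * τ) rfl
        refine ⟨i + 1, ?_⟩
        rwa [pow_succ', mul_inv_rev, mul_assoc]
  · intro m hm
    have gpow : ∀ i < m, g (σ ^ i) = i * g σ := by
      intro i
      induction i with
      | zero => intro _; simpa using g1
      | succ i ih =>
        intro hi
        have e1 := hout (σ ^ (i + 1)) (hm _ (Nat.succ_pos i) hi)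
        have e2 := left (σ ^ (i + 1))
        have e3 := ih (by omega)
        rw [show σ⁻¹ * σ ^ (i + 1) = σ ^ i by rw [pow_succ', inv_mul_cancel_left]] at e1 e2
        rw [add_mul, one_mul]
        omega
    intro i hi j hj
    have e := cases01 (σ ^ i) ((σ ^ i)⁻¹ * σ ^ j)
    rw [mul_inv_cancel_left, gpow i hi, gpow j hj] at e
    constructor
    · intro h
      by_contra! hji
      have : j * g σ < i * g σ := Nat.mul_lt_mul_of_pos_right hji hpos
      omega
    · intro hij
      have := hlt ((σ ^ i)⁻¹ * σ ^ j)
      have : i * g σ ≤ j * g σ := Nat.mul_le_mul_right _ hij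
      omega

end BinaryCocycle

/-! ### Group actions on local rings -/

section Action

variable {G S : Type*} [Group G] [CommRing S] [MulSemiringAction G S]

theorem isUnit_smul_iff_isUnit (σ : G) (s : S) : IsUnit (σ • s) ↔ IsUnit s := by
  refine ⟨fun h => ?_, fun h => h.map (MulSemiringAction.toRingHom G S σ)⟩
  simpa using h.map (MulSemiringAction.toRingHom G S σ⁻¹)

variable [IsLocalRing S]

open IsLocalRing

theorem smul_mem_maximalIdeal_iff (σ : G) (s : S) :
    σ • s ∈ maximalIdeal S ↔ s ∈ maximalIdeal S := by
  simp only [mem_maximalIdeal, mem_nonunits_iff, isUnit_smul_iff_isUnit]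

theorem smul_mem_maximalIdeal_sq {s : S} (hs : s ∈ maximalIdeal S ^ 2) (σ : G) :
    σ • s ∈ maximalIdeal S ^ 2 := by
  have h1 : (maximalIdeal S).map (MulSemiringAction.toRingHom G S σ) ≤ maximalIdeal S :=
    Ideal.map_le_iff_le_comap.mpr fun x hx => (smul_mem_maximalIdeal_iff σ x).mpr hx
  have h2 := Ideal.mem_map_of_mem (MulSemiringAction.toRingHom G S σ) hs
  rw [Ideal.map_pow] at h2
  exact Ideal.pow_right_mono h1 2 h2

theorem associated_smul_of_maximalIdeal_eq_span [IsDomain S] {ϖ : S}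
    (hϖ : maximalIdeal S = Ideal.span {ϖ}) (σ : G) : Associated (σ • ϖ) ϖ := by
  have mem : ϖ ∈ maximalIdeal S := hϖ ▸ Ideal.mem_span_singleton_self ϖ
  have dvd : ∀ τ : G, ϖ ∣ τ • ϖ := fun τ => by
    rw [← Ideal.mem_span_singleton, ← hϖ, smul_mem_maximalIdeal_iff]
    exact mem
  refine associated_of_dvd_dvd ?_ (dvd σ)
  simpa using map_dvd (MulSemiringAction.toRingHom G S σ) (dvd σ⁻¹)

end Action

/-! ### Cocycles with values outside the square of the maximal ideal -/

namespace NormalizedCocycle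

open IsLocalRing

variable {G S : Type*} [Group G] [CommRing S] [MulSemiringAction G S]
  (f : NormalizedCocycle G S)

theorem apply_inv_self (σ : G) : f σ⁻¹ σ = σ⁻¹ • f σ σ⁻¹ := by
  have h1 := f.cocycle σ σ⁻¹ σ
  rw [inv_mul_cancel, mul_inv_cancel, one_right, one_left, mul_one, mul_one] at h1
  rw [← h1, inv_smul_smul]

variable [IsLocalRing S]

/-- By the cocycle identity f(σ, τ) divides the conjugate σ • f(τ, τ⁻¹), and M² is stable under G.
-/
theorem notMem_sq_of_forall_inv (h : ∀ τ, f τ τ⁻¹ ∉ maximalIdeal S ^ 2) (σ τ : G) :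
    f σ τ ∉ maximalIdeal S ^ 2 := by
  intro hm
  have h1 := f.cocycle σ τ τ⁻¹
  rw [mul_inv_cancel, one_right, mul_one] at h1
  have h2 : σ • f τ τ⁻¹ ∈ maximalIdeal S ^ 2 := h1 ▸ Ideal.mul_mem_right _ _ hm
  have h3 := smul_mem_maximalIdeal_sq h2 σ⁻¹
  rw [inv_smul_smul] at h3
  exact h τ h3

/-- If no value of the cocycle lies in the square of the maximal ideal `(ϖ)`, then the graph is a
chain with cyclic underlying group. -/
theorem exists_generator [IsDomain S] [Fintype G] {ϖ : S} (hϖ : maximalIdeal S = Ideal.span {ϖ})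
    (h : ∀ σ τ, f σ τ ∉ maximalIdeal S ^ 2) (hne : f.unitSubgroup ≠ ⊤) :
    f.unitSubgroup.Normal ∧ ∃ σ, σ ∉ f.unitSubgroup ∧
      (∀ ρ, ρ ∉ f.unitSubgroup → IsUnit (f σ (σ⁻¹ * ρ)) ∧ IsUnit (f (ρ * σ⁻¹) σ)) ∧
      (∀ ρ, ρ ∈ f.unitSubgroup →
        Associated (f σ (σ⁻¹ * ρ)) ϖ ∧ Associated (f (ρ * σ⁻¹) σ) ϖ) ∧
      (∀ τ, ∃ i : ℕ, (σ ^ i)⁻¹ * τ ∈ f.unitSubgroup) ∧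
      ∀ m : ℕ, (∀ k, 0 < k → k < m → σ ^ k ∉ f.unitSubgroup) → ∀ i < m, ∀ j < m,
        (IsUnit (f (σ ^ i) ((σ ^ i)⁻¹ * σ ^ j)) ↔ i ≤ j) := by
  classical
  have hϖ_mem : ϖ ∈ maximalIdeal S := hϖ ▸ Ideal.mem_span_singleton_self ϖ
  have hϖu : ¬ IsUnit ϖ := (mem_maximalIdeal ϖ).mp hϖ_mem
  have hassoc : ∀ σ τ, ¬ IsUnit (f σ τ) → Associated (f σ τ) ϖ := by
    intro σ τ hu
    have h1 : f σ τ ∈ Ideal.span {ϖ} := hϖ ▸ (mem_maximalIdeal _).mpr hu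
    obtain ⟨a, ha⟩ := Ideal.mem_span_singleton.mp h1
    have hau : IsUnit a := by
      by_contra hau
      refine h σ τ ?_
      rw [ha, pow_two]
      exact Ideal.mul_mem_mul hϖ_mem ((mem_maximalIdeal a).mpr hau)
    obtain ⟨u, rfl⟩ := hau
    exact ⟨u⁻¹, by rw [ha, mul_assoc, Units.mul_inv, mul_one]⟩
  -- If ϖ = 0, a nonunit value of f would be zero, which is excluded; then H would be all of G.
  have hϖ0 : ϖ ≠ 0 := by
    rintro rfl
    refine hne (eq_top_iff.mpr fun σ _ => ?_)
    by_contra hσ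
    exact f.ne_zero' _ _ (associated_zero_iff_eq_zero _ |>.mp (hassoc σ σ⁻¹ hσ))
  set w : G → G → ℕ := fun σ τ => if IsUnit (f σ τ) then 0 else 1 with hwdef
  have w0 : ∀ σ τ, w σ τ = 0 ↔ IsUnit (f σ τ) := by
    intro σ τ
    by_cases hu : IsUnit (f σ τ) <;> simp [hwdef, hu]
  have w1 : ∀ σ τ, w σ τ = 1 → Associated (f σ τ) ϖ := by
    intro σ τ hs
    refine hassoc σ τ fun hu => ?_
    rw [(w0 σ τ).mpr hu] at hs
    exact zero_ne_one hs
  have hwpow : ∀ σ τ, Associated (f σ τ) (ϖ ^ w σ τ) := by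
    intro σ τ
    by_cases hu : IsUnit (f σ τ)
    · simp [hwdef, hu, associated_one_iff_isUnit]
    · simpa [hwdef, hu] using hassoc σ τ hu
  have hsmul : ∀ σ : G, ∀ k : ℕ, Associated (σ • ϖ ^ k) (ϖ ^ k) := by
    intro σ k
    rw [smul_pow']
    exact (associated_smul_of_maximalIdeal_eq_span hϖ σ).pow_pow
  have hinj : ∀ a b : ℕ, Associated (ϖ ^ a) (ϖ ^ b) → a = b := fun a b hab =>
    le_antisymm ((pow_dvd_pow_iff hϖ0 hϖu).mp hab.dvd) ((pow_dvd_pow_iff hϖ0 hϖu).mp hab.symm.dvd)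
  have hc : ∀ σ τ γ, w τ γ + w σ (τ * γ) = w σ τ + w (σ * τ) γ := by
    intro σ τ γ
    apply hinj
    rw [pow_add, pow_add]
    refine Associated.trans ?_ ((hwpow σ τ).mul_mul (hwpow (σ * τ) γ))
    rw [← f.cocycle]
    refine Associated.mul_mul ?_ (hwpow _ _).symm
    exact ((hsmul σ _).symm.trans
      ((hwpow τ γ).symm.map (MulSemiringAction.toRingHom G S σ)))
  obtain ⟨hN, σ, hσ, a1, a2, a3, a4⟩ := exists_generator_of_binaryCocycle (w := w)
    (fun σ τ => by simp only [hwdef]; split_ifs <;> omega)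
    (fun σ => (w0 _ _).mpr (by rw [one_right]; exact isUnit_one)) hc f.unitSubgroup
    (fun σ => (w0 σ σ⁻¹).symm) hne
  refine ⟨hN, σ, hσ, fun ρ hρ => ?_, fun ρ hρ => ?_, a3, fun m hm i hi j hj => ?_⟩
  · exact ⟨(w0 _ _).mp (a1 ρ hρ).1, (w0 _ _).mp (a1 ρ hρ).2⟩
  · exact ⟨w1 _ _ (a2 ρ hρ).1, w1 _ _ (a2 ρ hρ).2⟩
  · rw [← w0]; exact a4 m hm i hi j hj

end NormalizedCocycle

/-! ### Coefficients and basis elements of the crossed product -/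

namespace NormalizedCocycle

variable {G S : Type*} [Group G] [CommRing S] [MulSemiringAction G S]
  (f : NormalizedCocycle G S)

namespace CrossedProduct

variable [DecidableEq G]

theorem single_apply (σ τ : G) (r : S) : single f σ r τ = if τ = σ then r else 0 := rfl

variable [Fintype G]

theorem single_add (σ : G) (r s : S) : single f σ (r + s) = single f σ r + single f σ s := by
  ext τ
  simp only [add_apply, single_apply]
  split_ifs <;> simp

theorem single_zero (σ : G) : single f σ (0 : S) = 0 := by
  ext τ
  simp [single_apply, zero_apply]

/-- The coefficient ring inside the crossed product. -/
def coeffHom : S →+* f.CrossedProduct where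
  toFun := single f 1
  map_one' := rfl
  map_mul' r s := by rw [single_mul_single]; simp [one_left]
  map_zero' := single_zero f 1
  map_add' := single_add f 1

theorem coeffHom_apply (s : S) : coeffHom f s = single f 1 s := rfl

theorem coeffHom_mul_single (s r : S) (σ : G) :
    coeffHom f s * single f σ r = single f σ (s * r) := by
  rw [coeffHom_apply, single_mul_single]
  simp [one_left]

theorem single_mul_coeffHom (s r : S) (σ : G) :
    single f σ r * coeffHom f s = single f σ (r * σ • s) := by
  rw [coeffHom_apply, single_mul_single]
  simp [one_right]

theorem coeffHom_mul_apply (s : S) (a : f.CrossedProduct) (σ : G) :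
    (coeffHom f s * a) σ = s * a σ := by
  rw [mul_apply, Finset.sum_eq_single 1]
  · simp [coeffHom_apply, single_apply, one_left]
  · intro τ _ hτ
    simp [coeffHom_apply, single_apply, hτ]
  · simp

theorem single_mul_apply (σ ρ : G) (s : S) (a : f.CrossedProduct) :
    (single f σ s * a) ρ = s * σ • a (σ⁻¹ * ρ) * f σ (σ⁻¹ * ρ) := by
  rw [mul_apply, Finset.sum_eq_single σ]
  · simp [single_apply]
  · intro τ _ hτ
    simp [single_apply, hτ]
  · simp

theorem x_mul_apply (σ ρ : G) (a : f.CrossedProduct) :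
    (x f σ * a) ρ = σ • a (σ⁻¹ * ρ) * f σ (σ⁻¹ * ρ) := by
  rw [x, single_mul_apply, one_mul]

theorem mul_x_apply (σ ρ : G) (a : f.CrossedProduct) :
    (a * x f σ) ρ = a (ρ * σ⁻¹) * f (ρ * σ⁻¹) σ := by
  rw [mul_apply, Finset.sum_eq_single (ρ * σ⁻¹)]
  · simp [x, single_apply]
  · intro τ _ hτ
    have : τ⁻¹ * ρ ≠ σ := fun h => hτ (by rw [← h]; group)
    simp [x, single_apply, this]
  · simp

theorem sum_apply {ι : Type*} (s : Finset ι) (F : ι → f.CrossedProduct) (σ : G) :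
    (∑ i ∈ s, F i) σ = ∑ i ∈ s, F i σ := Finset.sum_apply σ s F

theorem eq_sum_coeffHom_mul_x (a : f.CrossedProduct) :
    a = ∑ σ, coeffHom f (a σ) * x f σ := by
  ext τ
  rw [sum_apply, Finset.sum_eq_single τ]
  · rw [x, coeffHom_mul_single]
    simp [single_apply]
  · intro σ _ hσ
    rw [x, coeffHom_mul_single]
    simp [single_apply, hσ.symm]
  · simp

theorem coeffHom_mul_comm {z : S} (hz : ∀ σ : G, σ • z = z) (a : f.CrossedProduct) :
    a * coeffHom f z = coeffHom f z * a := by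
  rw [eq_sum_coeffHom_mul_x f a, Finset.sum_mul, Finset.mul_sum]
  refine Finset.sum_congr rfl fun σ _ => ?_
  rw [mul_assoc, x, single_mul_coeffHom, coeffHom_mul_single, coeffHom_mul_single,
    coeffHom_mul_single, hz]
  congr 1
  ring

/-! ### Averaging -/

variable {f}

/-- Averaging over a subgroup `K` turns a map that is semilinear over the coefficients into a
map that is linear over the crossed product. -/
theorem exists_average [IsDomain S] (K : Subgroup G) [DecidablePred (· ∈ K)] {z : S} {d : G → S}
    (hd : ∀ σ ∈ K, d σ * f σ⁻¹ σ = z) (c : S) {N P : Type*} [AddCommGroup N] [AddCommGroup P]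
    [Module f.CrossedProduct N] [Module f.CrossedProduct P] (g : N →+ P)
    (hg : ∀ s n, g (coeffHom f s • n) = coeffHom f s • g n)
    (hN : ∀ τ, τ ∉ K → ∀ n : N, x f τ • n = 0) (hP : ∀ τ, τ ∉ K → ∀ n : P, x f τ • n = 0) :
    ∃ h : N →ₗ[f.CrossedProduct] P, ∀ n,
      h n = ∑ σ : K, (x f σ * coeffHom f c) • g (single f (σ : G)⁻¹ (d σ) • n) := by
  -- Since d(σ) x_{σ⁻¹} x_σ = z, the element d(σ) x_{σ⁻¹} plays the role of z x_σ⁻¹, and this is the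
  -- usual average of the conjugates of c g.
  let h : N →+ P := ∑ σ : K, (DistribSMul.toAddMonoidHom P (x f σ * coeffHom f c)).comp
    (g.comp (DistribSMul.toAddMonoidHom N (single f (σ : G)⁻¹ (d σ))))
  have h_apply : ∀ n, h n =
      ∑ σ : K, (x f σ * coeffHom f c) • g (single f (σ : G)⁻¹ (d σ) • n) := by
    intro n
    simp [h]
  have h_coeff : ∀ s n, h (coeffHom f s • n) = coeffHom f s • h n := by
    intro s n
    rw [h_apply, h_apply, Finset.smul_sum]
    refine Finset.sum_congr rfl fun σ _ => ?_
    rw [smul_smul, single_mul_coeffHom, mul_comm, ← coeffHom_mul_single,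
      mul_smul (coeffHom f ((σ : G)⁻¹ • s)), hg, smul_smul, smul_smul]
    congr 1
    rw [x, single_mul_coeffHom, single_mul_coeffHom, coeffHom_mul_single, smul_inv_smul]
    congr 1
    ring
  have h_x : ∀ τ n, h (x f τ • n) = x f τ • h n := by
    intro τ n
    by_cases hτ : τ ∈ K
    · rw [h_apply, h_apply, Finset.smul_sum]
      refine Fintype.sum_equiv (Equiv.mulLeft (⟨τ, hτ⟩ : K)⁻¹) _ _ fun σ => ?_
      obtain ⟨σ, hσ⟩ := σ
      obtain ⟨ρ, rfl⟩ : ∃ ρ, σ = τ * ρ := ⟨τ⁻¹ * σ, by rw [mul_inv_cancel_left]⟩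
      have hρ : ρ ∈ K := (K.mul_mem_cancel_left hτ).mp hσ
      have hval : (⟨τ, hτ⟩ : K)⁻¹ * ⟨τ * ρ, hσ⟩ = ⟨ρ, hρ⟩ := by
        ext; simp
      simp only [Equiv.coe_mulLeft, hval]
      have hrel : d (τ * ρ) * f (τ * ρ)⁻¹ τ = (τ * ρ)⁻¹ • f τ ρ * d ρ := by
        have h1 := f.cocycle (τ * ρ)⁻¹ τ ρ
        rw [show (τ * ρ)⁻¹ * τ = ρ⁻¹ by group] at h1
        have h2 := hd _ hσ
        have h3 := hd _ hρ
        have h4 : f ρ⁻¹ ρ ≠ 0 := f.ne_zero' _ _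
        apply mul_right_cancel₀ h4
        linear_combination (-d (τ * ρ)) * h1 + ((τ * ρ)⁻¹ • f τ ρ) * h2 -
          ((τ * ρ)⁻¹ • f τ ρ) * h3
      have hy : single f (τ * ρ)⁻¹ (d (τ * ρ)) * x f τ =
          coeffHom f ((τ * ρ)⁻¹ • f τ ρ) * single f ρ⁻¹ (d ρ) := by
        rw [x, single_mul_single, coeffHom_mul_single, smul_one, mul_one, hrel,
          show (τ * ρ)⁻¹ * τ = ρ⁻¹ by group]
      rw [smul_smul, hy, mul_smul (coeffHom f ((τ * ρ)⁻¹ • f τ ρ)), hg, smul_smul, smul_smul]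
      congr 1
      rw [x, x, x, single_mul_coeffHom, single_mul_coeffHom, single_mul_coeffHom,
        single_mul_single, smul_inv_smul]
      congr 1
      simp only [one_mul, smul_smul]
    · rw [hN τ hτ, hP τ hτ, map_zero]
  refine ⟨{ toFun := h, map_add' := map_add h, map_smul' := fun a n => ?_ }, h_apply⟩
  rw [RingHom.id_apply]
  conv_lhs => rw [eq_sum_coeffHom_mul_x f a]
  conv_rhs => rw [eq_sum_coeffHom_mul_x f a]
  rw [Finset.sum_smul, Finset.sum_smul, map_sum]
  refine Finset.sum_congr rfl fun τ _ => ?_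
  rw [mul_smul, mul_smul, h_coeff, h_x]

/-- The term at σ is σ(c) z, so the trace condition on c computes the factor that averaging
introduces. -/
theorem sum_x_mul_single (K : Subgroup G) [DecidablePred (· ∈ K)] {z : S}
    (hz : ∀ σ ∈ K, σ • z = z) {d : G → S} (hd : ∀ σ ∈ K, d σ * f σ⁻¹ σ = z) {c : S}
    (hc : ∑ σ : K, (σ : G) • c = 1) :
    ∑ σ : K, x f σ * coeffHom f c * single f (σ : G)⁻¹ (d σ) = coeffHom f z := by
  have h1 : ∀ σ : K, x f σ * coeffHom f c * single f (σ : G)⁻¹ (d σ) =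
      coeffHom f ((σ : G) • c * z) := by
    intro σ
    rw [x, single_mul_coeffHom, single_mul_single, coeffHom_apply, mul_inv_cancel, one_mul,
      mul_assoc]
    congr 2
    have h := congrArg (fun s => (σ : G) • s) (hd σ σ.2)
    simp only [smul_mul', hz _ σ.2] at h
    have h2 : (σ : G) • f (σ : G)⁻¹ σ = f (σ : G) (σ : G)⁻¹ := by
      have h1 := f.cocycle σ (σ : G)⁻¹ σ
      rwa [inv_mul_cancel, mul_inv_cancel, one_right, one_left, mul_one, mul_one] at h1
    rwa [h2] at h
  rw [Finset.sum_congr rfl fun σ _ => h1 σ, ← map_sum, ← Finset.sum_mul, hc, one_mul]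

/-- A coefficientwise split surjection onto `N` is split up to the factor `z`. -/
theorem exists_comp_eq_smul [IsDomain S] {z : S} (hz : ∀ σ : G, σ • z = z)
    (hd : ∀ σ : G, f σ⁻¹ σ ∣ z) {c : S} (hc : ∑ σ : G, σ • c = 1)
    {N P : Type*} [AddCommGroup N] [AddCommGroup P]
    [Module f.CrossedProduct N] [Module f.CrossedProduct P]
    (p : P →ₗ[f.CrossedProduct] N) (g : N →+ P)
    (hg : ∀ s n, g (coeffHom f s • n) = coeffHom f s • g n) (hpg : ∀ n, p (g n) = n) :
    ∃ h : N →ₗ[f.CrossedProduct] P, ∀ n, p (h n) = coeffHom f z • n := by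
  classical
  choose d hd using hd
  have hd' : ∀ σ ∈ (⊤ : Subgroup G), d σ * f σ⁻¹ σ = z := fun σ _ => by rw [hd σ, mul_comm]
  have hc' : ∑ σ : (⊤ : Subgroup G), (σ : G) • c = 1 := by
    rw [← hc]
    exact Fintype.sum_equiv Subgroup.topEquiv.toEquiv _ _ fun _ => rfl
  obtain ⟨h, hh⟩ := exists_average (⊤ : Subgroup G) hd' c g hg
    (fun τ hτ => absurd (Subgroup.mem_top τ) hτ) (fun τ hτ => absurd (Subgroup.mem_top τ) hτ)
  refine ⟨h, fun n => ?_⟩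
  rw [hh, map_sum, ← sum_x_mul_single ⊤ (fun σ _ => hz σ) hd' hc', Finset.sum_smul]
  refine Finset.sum_congr rfl fun σ _ => ?_
  rw [map_smul, hpg, smul_smul]

/-- Such a W is a vector space over the residue field, so D has a complement. -/
theorem exists_retraction_of_maximalIdeal_smul [IsLocalRing S] {W : Type*} [AddCommGroup W]
    [Module S W] (hW : ∀ s ∈ IsLocalRing.maximalIdeal S, ∀ w : W, s • w = 0)
    (D : Submodule S W) : ∃ g : W →ₗ[S] D, ∀ d : D, g d = d := by
  have ht : Module.IsTorsionBySet S W (IsLocalRing.maximalIdeal S) := fun w s => hW s s.2 w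
  let : Field (S ⧸ IsLocalRing.maximalIdeal S) := Ideal.Quotient.field _
  let := ht.module
  have hss : IsSemisimpleModule S W :=
    ht.isSemisimpleModule_iff.mp inferInstance
  obtain ⟨E, hE⟩ := exists_isCompl D
  exact ⟨D.projectionOnto E hE, fun d => Submodule.projectionOnto_apply_left hE d⟩

/-- A module over the crossed product that is killed by the maximal ideal and by all `x_τ` with
`τ ∉ H` is semisimple. -/
theorem isSemisimpleModule_of_smul_eq_zero [IsDomain S] [IsLocalRing S] {c : S}
    (hc : ∑ σ : G, σ • c = 1)
    (W : Type*) [AddCommGroup W] [Module f.CrossedProduct W]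
    (hM : ∀ s ∈ IsLocalRing.maximalIdeal S, ∀ w : W, coeffHom f s • w = 0)
    (hx : ∀ τ, τ ∉ f.unitSubgroup → ∀ w : W, x f τ • w = 0) :
    IsSemisimpleModule f.CrossedProduct W := by
  classical
  -- An element of H-trace 1 comes from summing the translates of c over representatives of the
  -- right cosets of H.
  obtain ⟨c', hc'⟩ : ∃ c' : S, ∑ σ : f.unitSubgroup, (σ : G) • c' = 1 := by
    obtain ⟨T, hT, -⟩ := f.unitSubgroup.exists_isComplement_right 1
    refine ⟨∑ t : T, (t : G) • c, ?_⟩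
    rw [← hc, ← Fintype.sum_equiv (Equiv.ofBijective _ hT)
      (fun y => (y.1 : G) • (y.2 : G) • c) _ fun y => smul_smul _ _ _, Fintype.sum_prod_type]
    exact Finset.sum_congr rfl fun σ _ => Finset.smul_sum
  have hunit : ∀ σ ∈ f.unitSubgroup, IsUnit (f σ⁻¹ σ) := fun σ hσ =>
    f.isUnit_of_mem_right hσ _
  let d : G → S := fun σ => Ring.inverse (f σ⁻¹ σ)
  have hd : ∀ σ ∈ f.unitSubgroup, d σ * f σ⁻¹ σ = 1 := fun σ hσ =>
    Ring.inverse_mul_cancel _ (hunit σ hσ)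
  let : Module S W := Module.compHom W (coeffHom f)
  refine (isSemisimpleModule_iff _ _).mpr ⟨fun D => ?_⟩
  let D' : Submodule S W := { D with smul_mem' := fun s w hw => D.smul_mem _ hw }
  obtain ⟨g, hg⟩ := exists_retraction_of_maximalIdeal_smul hM D'
  let g' : W →+ D := g.toAddMonoidHom
  obtain ⟨h, hh⟩ := exists_average f.unitSubgroup hd c' g'
    (fun s n => map_smul g s n) hx (fun τ hτ n => Subtype.ext (hx τ hτ n))
  refine ⟨h.ker, LinearMap.isCompl_of_proj fun w => ?_⟩
  rw [hh]
  have h1 : ∀ w : D, g' (w : W) = w := hg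
  have h2 := sum_x_mul_single f.unitSubgroup (fun σ _ => smul_one σ) hd hc'
  rw [map_one] at h2
  conv_rhs => rw [← one_smul f.CrossedProduct w, ← h2, Finset.sum_smul]
  refine Finset.sum_congr rfl fun σ _ => ?_
  rw [mul_smul (x f (σ : G) * coeffHom f c'), ← h1 (single f (σ : G)⁻¹ (d σ) • w)]
  rfl

end CrossedProduct

end NormalizedCocycle

/-! ### Splitting surjections -/

section Splitting

variable {A : Type*} [Ring A] {N P : Type*} [AddCommGroup N] [AddCommGroup P] [Module A N]
  [Module A P]

/-- A surjection from a projective module which is split up to a central factor `z` splits, if the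
partial section is divisible by `z`. -/
theorem Module.Projective.of_comp_eq_smul [Module.Projective A P] {z : A}
    (hz : ∀ a, a * z = z * a) (hP : ∀ m : P, z • m = 0 → m = 0) (hN : ∀ n : N, z • n = 0 → n = 0)
    (p : P →ₗ[A] N) (h : N →ₗ[A] P) (hph : ∀ n, p (h n) = z • n) (hdvd : ∀ n, ∃ m, h n = z • m) :
    Module.Projective A N := by
  choose s hs using hdvd
  have hinj : ∀ m m' : P, z • m = z • m' → m = m' := fun m m' hm =>
    sub_eq_zero.mp (hP _ (by rw [smul_sub, hm, sub_self]))
  let s' : N →ₗ[A] P :=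
    { toFun := s
      map_add' := fun a b => hinj _ _ (by rw [smul_add, ← hs, ← hs, ← hs, map_add])
      map_smul' := fun a b => hinj _ _ (by
        rw [RingHom.id_apply, smul_smul, ← hz, mul_smul, ← hs, ← hs, map_smul]) }
  refine Module.Projective.of_split s' p (LinearMap.ext fun n => ?_)
  refine sub_eq_zero.mp (hN _ ?_)
  change z • (p (s n) - n) = 0
  rw [smul_sub, ← map_smul, ← hs, hph, sub_self]

/-- If `y` is a normal element such that modules killed by `y` are semisimple, then a surjection
onto a module on which `y` is injective splits modulo every power of `y`. -/
theorem exists_submodule_inf_ker_le_pow_smul {y : A} (hy : ∀ a, ∃ b, a * y = y * b)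
    (hss : ∀ (Q : Submodule A P) (T : Submodule A Q), (∀ w : Q ⧸ T, y • w = 0) →
      IsSemisimpleModule A (Q ⧸ T))
    (p : P →ₗ[A] N) (hp : Function.Surjective p) (hN : ∀ n : N, y • n = 0 → n = 0) (j : ℕ) :
    ∃ Q : Submodule A P, (∀ n, ∃ q ∈ Q, p q = n) ∧
      ∀ q ∈ Q, p q = 0 → ∃ l, p l = 0 ∧ q = y ^ j • l := by
  induction j with
  | zero =>
    refine ⟨⊤, fun n => ?_, fun q _ hq => ⟨q, hq, by rw [pow_zero, one_smul]⟩⟩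
    obtain ⟨q, hq⟩ := hp n
    exact ⟨q, trivial, hq⟩
  | succ j ih =>
    obtain ⟨Q, hQ, hQp⟩ := ih
    let T : Submodule A Q :=
      { carrier := {q | ∃ q' : Q, q = y • q'}
        zero_mem' := ⟨0, (smul_zero _).symm⟩
        add_mem' := by
          rintro _ _ ⟨a, rfl⟩ ⟨b, rfl⟩
          exact ⟨a + b, (smul_add _ _ _).symm⟩
        smul_mem' := by
          rintro c _ ⟨a, rfl⟩
          obtain ⟨b, hb⟩ := hy c
          exact ⟨b • a, by rw [smul_smul, hb, mul_smul]⟩ }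
    have hT : ∀ w : Q ⧸ T, y • w = 0 := by
      intro w
      obtain ⟨q, rfl⟩ := T.mkQ_surjective w
      rw [← map_smul, Submodule.mkQ_apply, Submodule.Quotient.mk_eq_zero]
      exact ⟨q, rfl⟩
    have := hss Q T hT
    -- T is yQ, and D is the image of the kernel of p. The preimage of a complement of D still maps
    -- onto N, and meets the kernel only inside yQ, which gains one power of y.
    let D : Submodule A (Q ⧸ T) := ((LinearMap.ker p).comap Q.subtype).map T.mkQ
    obtain ⟨C, hC⟩ := exists_isCompl D
    refine ⟨(C.comap T.mkQ).map Q.subtype, fun n => ?_, ?_⟩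
    · obtain ⟨q, hq, rfl⟩ := hQ n
      have hmem : T.mkQ ⟨q, hq⟩ ∈ D ⊔ C := hC.sup_eq_top ▸ Submodule.mem_top
      obtain ⟨_, ⟨d, hd, rfl⟩, e, he, hde⟩ := Submodule.mem_sup.mp hmem
      refine ⟨q - d, ⟨⟨q, hq⟩ - d, ?_, rfl⟩, ?_⟩
      · change T.mkQ (⟨q, hq⟩ - d) ∈ C
        rw [map_sub, ← hde, add_sub_cancel_left]
        exact he
      · have hd' : p d = 0 := hd
        rw [map_sub, hd', sub_zero]
    · rintro _ ⟨q, hq, rfl⟩ hpq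
      have h0 : T.mkQ q ∈ D ⊓ C := ⟨⟨q, hpq, rfl⟩, hq⟩
      rw [hC.inf_eq_bot, Submodule.mem_bot, Submodule.mkQ_apply,
        Submodule.Quotient.mk_eq_zero] at h0
      obtain ⟨q', rfl⟩ := h0
      have hq' : p q' = 0 := hN _ (by rw [← map_smul]; exact hpq)
      obtain ⟨l, hl, hql⟩ := hQp q' q'.2 hq'
      refine ⟨l, hl, ?_⟩
      rw [pow_succ', mul_smul, ← hql]
      rfl

end Splitting

/-! ### Projectivity of torsion-free modules over the crossed product -/

namespace NormalizedCocycle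

open IsLocalRing

variable {G S : Type*} [Group G] [CommRing S] [MulSemiringAction G S]
  {f : NormalizedCocycle G S}

namespace CrossedProduct

variable [DecidableEq G] [Fintype G]

theorem coeffHom_mul_eq_zero [IsDomain S] {s : S} (hs : s ≠ 0) {a : f.CrossedProduct}
    (h : coeffHom f s * a = 0) : a = 0 := by
  ext σ
  have h1 : (coeffHom f s * a) σ = 0 := by rw [h]; rfl
  rw [coeffHom_mul_apply] at h1
  exact (mul_eq_zero.mp h1).resolve_left hs

/-- Surjections onto finitely generated torsion-free modules split over the coefficients. -/
theorem exists_coeff_section [IsDomain S] [ValuationRing S] {N P : Type*} [AddCommGroup N]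
    [AddCommGroup P] [Module f.CrossedProduct N] [Module f.CrossedProduct P]
    [Module.Finite f.CrossedProduct N]
    (hN : ∀ s : S, s ≠ 0 → ∀ n : N, coeffHom f s • n = 0 → n = 0)
    (p : P →ₗ[f.CrossedProduct] N) (hp : Function.Surjective p) :
    ∃ g : N →+ P, (∀ s n, g (coeffHom f s • n) = coeffHom f s • g n) ∧ ∀ n, p (g n) = n := by
  let : Module S f.CrossedProduct := Module.compHom _ (coeffHom f)
  let : Module S N := Module.compHom N (coeffHom f)
  let : Module S P := Module.compHom P (coeffHom f)
  have : IsScalarTower S f.CrossedProduct N := ⟨fun s a n => mul_smul (coeffHom f s) a n⟩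
  have : Module.Finite S f.CrossedProduct := by
    classical
    refine ⟨⟨Finset.univ.image (x f), eq_top_iff.mpr fun a _ => ?_⟩⟩
    rw [eq_sum_coeffHom_mul_x f a]
    refine Submodule.sum_mem _ fun σ _ => ?_
    exact Submodule.smul_mem _ (a σ) (Submodule.subset_span (by simp))
  have : Module.Finite S N := Module.Finite.trans f.CrossedProduct N
  have : Module.IsTorsionFree S N := by
    refine ⟨fun s hs n n' h => sub_eq_zero.mp (hN s hs.ne_zero _ ?_)⟩
    rw [smul_sub]
    exact sub_eq_zero.mpr h
  -- Over a valuation ring torsion-free modules are flat, and finitely generated flat modules over a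
  -- local ring are free.
  have : Module.Flat S N := Module.Flat.flat_iff_torsion_eq_bot_of_isBezout.mpr
    (Submodule.isTorsionFree_iff_torsion_eq_bot.mp this)
  have : Module.Free S N := Module.free_of_flat_of_isLocalRing
  let p' : P →ₗ[S] N := { p with map_smul' := fun s m => p.map_smul (coeffHom f s) m }
  obtain ⟨g, hg⟩ := Module.projective_lifting_property p' LinearMap.id hp
  exact ⟨g.toAddMonoidHom, fun s n => g.map_smul s n, fun n => LinearMap.congr_fun hg n⟩

/-- The coefficient of x_σ b at ρ is an arbitrary multiple of f(σ, σ⁻¹ρ), which is a unit off H and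
an associate of ϖ on H. The right-handed version has the same right-hand side, so x_σ A = A x_σ. -/
theorem mem_range_x_mul_iff [IsLocalRing S] {ϖ : S} (hϖ : maximalIdeal S = Ideal.span {ϖ}) {σ : G}
    (hout : ∀ ρ, ρ ∉ f.unitSubgroup → IsUnit (f σ (σ⁻¹ * ρ)))
    (hin : ∀ ρ, ρ ∈ f.unitSubgroup → Associated (f σ (σ⁻¹ * ρ)) ϖ) (a : f.CrossedProduct) :
    (∃ b, a = x f σ * b) ↔ ∀ ρ ∈ f.unitSubgroup, a ρ ∈ maximalIdeal S := by
  constructor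
  · rintro ⟨b, rfl⟩ ρ hρ
    rw [x_mul_apply, hϖ, Ideal.mem_span_singleton]
    exact (hin ρ hρ).symm.dvd.mul_left _
  · intro ha
    have hdvd : ∀ ρ, f σ (σ⁻¹ * ρ) ∣ a ρ := by
      intro ρ
      by_cases hρ : ρ ∈ f.unitSubgroup
      · refine (hin ρ hρ).dvd.trans ?_
        rw [← Ideal.mem_span_singleton, ← hϖ]
        exact ha ρ hρ
      · exact (hout ρ hρ).dvd
    choose e he using hdvd
    let b : f.CrossedProduct := fun κ => σ⁻¹ • e (σ * κ)
    refine ⟨b, CrossedProduct.ext fun ρ => ?_⟩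
    have hb : σ • b (σ⁻¹ * ρ) = e ρ := by
      change σ • σ⁻¹ • e (σ * (σ⁻¹ * ρ)) = e ρ
      rw [smul_inv_smul, mul_inv_cancel_left]
    rw [x_mul_apply, hb, he ρ, mul_comm]

theorem mem_range_mul_x_iff [IsLocalRing S] {ϖ : S} (hϖ : maximalIdeal S = Ideal.span {ϖ}) {σ : G}
    (hout : ∀ ρ, ρ ∉ f.unitSubgroup → IsUnit (f (ρ * σ⁻¹) σ))
    (hin : ∀ ρ, ρ ∈ f.unitSubgroup → Associated (f (ρ * σ⁻¹) σ) ϖ) (a : f.CrossedProduct) :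
    (∃ b, a = b * x f σ) ↔ ∀ ρ ∈ f.unitSubgroup, a ρ ∈ maximalIdeal S := by
  constructor
  · rintro ⟨b, rfl⟩ ρ hρ
    rw [mul_x_apply, hϖ, Ideal.mem_span_singleton]
    exact (hin ρ hρ).symm.dvd.mul_left _
  · intro ha
    have hdvd : ∀ ρ, f (ρ * σ⁻¹) σ ∣ a ρ := by
      intro ρ
      by_cases hρ : ρ ∈ f.unitSubgroup
      · refine (hin ρ hρ).dvd.trans ?_
        rw [← Ideal.mem_span_singleton, ← hϖ]
        exact ha ρ hρ
      · exact (hout ρ hρ).dvd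
    choose e he using hdvd
    let b : f.CrossedProduct := fun κ => e (κ * σ)
    refine ⟨b, CrossedProduct.ext fun ρ => ?_⟩
    have hb : b (ρ * σ⁻¹) = e ρ := by
      change e (ρ * σ⁻¹ * σ) = e ρ
      rw [inv_mul_cancel_right]
    rw [mul_x_apply, hb, he ρ, mul_comm]

theorem exists_x_pow_eq_single [IsDomain S] (σ : G) (k : ℕ) :
    ∃ r : S, r ≠ 0 ∧ x f σ ^ k = single f (σ ^ k) r := by
  induction k with
  | zero => exact ⟨1, one_ne_zero, by rw [pow_zero, pow_zero]; rfl⟩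
  | succ k ih =>
    obtain ⟨r, hr, h⟩ := ih
    refine ⟨r * f (σ ^ k) σ, mul_ne_zero hr (f.ne_zero' _ _), ?_⟩
    rw [pow_succ, h, x, single_mul_single, smul_one, mul_one, pow_succ]

/-- If `x_σ A` is contained in `{a | ∀ ρ ∈ H, a ρ ∈ M}`, some power of `x_σ` lies in `M`. -/
theorem exists_x_pow_eq_coeffHom [IsDomain S] [IsLocalRing S] {σ : G}
    (h : ∀ b, (x f σ * b) 1 ∈ maximalIdeal S) :
    ∃ k : ℕ, ∃ r ∈ maximalIdeal S, r ≠ 0 ∧ x f σ ^ k = coeffHom f r := by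
  obtain ⟨r, hr0, hr⟩ := exists_x_pow_eq_single (f := f) σ (orderOf σ)
  rw [pow_orderOf_eq_one] at hr
  refine ⟨orderOf σ, r, ?_, hr0, hr⟩
  have h1 := h (x f σ ^ (orderOf σ - 1))
  rwa [← pow_succ', Nat.sub_add_cancel (orderOf_pos σ), hr, single_apply, if_pos rfl] at h1

theorem dvd_of_notMem_maximalIdeal_sq [IsLocalRing S] {ϖ s : S}
    (hϖ : maximalIdeal S = Ideal.span {ϖ}) (hs : s ∉ maximalIdeal S ^ 2) : s ∣ ϖ := by
  by_cases hu : IsUnit s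
  · exact hu.dvd
  · have h1 : s ∈ Ideal.span {ϖ} := hϖ ▸ (mem_maximalIdeal s).mpr hu
    obtain ⟨a, rfl⟩ := Ideal.mem_span_singleton.mp h1
    have ha : IsUnit a := by
      by_contra ha
      rw [pow_two] at hs
      exact hs (Ideal.mul_mem_mul (hϖ ▸ Ideal.mem_span_singleton_self ϖ)
        ((mem_maximalIdeal a).mpr ha))
    exact ha.mul_right_dvd.mpr dvd_rfl

/-- The right ideal x_σ A contains M and every x_τ with τ outside H, so the Maschke argument over H
applies. -/
theorem isSemisimpleModule_of_x_smul_eq_zero [IsDomain S] [IsLocalRing S] {c : S}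
    (hc : ∑ σ : G, σ • c = 1) {ϖ : S} (hϖ : maximalIdeal S = Ideal.span {ϖ}) {σ : G}
    (hout : ∀ ρ, ρ ∉ f.unitSubgroup → IsUnit (f σ (σ⁻¹ * ρ)))
    (hin : ∀ ρ, ρ ∈ f.unitSubgroup → Associated (f σ (σ⁻¹ * ρ)) ϖ)
    (W : Type*) [AddCommGroup W] [Module f.CrossedProduct W] (hW : ∀ w : W, x f σ • w = 0) :
    IsSemisimpleModule f.CrossedProduct W := by
  have hkill : ∀ a : f.CrossedProduct, (∀ ρ ∈ f.unitSubgroup, a ρ ∈ maximalIdeal S) →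
      ∀ w : W, a • w = 0 := by
    intro a ha w
    obtain ⟨b, rfl⟩ := (mem_range_x_mul_iff hϖ hout hin a).mpr ha
    rw [mul_smul, hW]
  refine isSemisimpleModule_of_smul_eq_zero hc W (fun s hs => hkill _ fun ρ hρ => ?_)
    fun τ hτ => hkill _ fun ρ hρ => ?_
  · rw [coeffHom_apply, single_apply]
    split_ifs
    exacts [hs, zero_mem _]
  · rw [x, single_apply, if_neg fun h : ρ = τ => hτ (h ▸ hρ)]
    exact zero_mem _

/-- If no value of the cocycle lies in `J(S)²`, finitely generated torsion-free modules over the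
crossed product are projective. -/
theorem projective_of_forall_notMem_sq [IsDomain S] [ValuationRing S] {c : S}
    (hc : ∑ σ : G, σ • c = 1) {ϖ : S} (hϖ : maximalIdeal S = Ideal.span {ϖ})
    (hf : ∀ σ τ, f σ τ ∉ maximalIdeal S ^ 2)
    (N : Type*) [AddCommGroup N] [Module f.CrossedProduct N] [Module.Finite f.CrossedProduct N]
    (hN : ∀ s : S, s ≠ 0 → ∀ n : N, coeffHom f s • n = 0 → n = 0) :
    Module.Projective f.CrossedProduct N := by
  obtain ⟨n, p, hp⟩ := Module.Finite.exists_fin' f.CrossedProduct N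
  by_cases hH : f.unitSubgroup = ⊤
  · obtain ⟨g, hg, hpg⟩ := exists_coeff_section hN p hp
    obtain ⟨h, hh⟩ := exists_comp_eq_smul (z := 1) (fun σ => smul_one σ)
      (fun σ => (f.isUnit_of_mem_right (hH ▸ Subgroup.mem_top σ) _).dvd) hc p g hg hpg
    refine Module.Projective.of_split h p (LinearMap.ext fun n => ?_)
    rw [LinearMap.comp_apply, hh, map_one, one_smul]
    rfl
  obtain ⟨-, σ, hσ, hout, hin, -⟩ := f.exists_generator hϖ hf hH
  have hL := mem_range_x_mul_iff hϖ (fun ρ hρ => (hout ρ hρ).1) fun ρ hρ => (hin ρ hρ).1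
  have hR := mem_range_mul_x_iff hϖ (fun ρ hρ => (hout ρ hρ).2) fun ρ hρ => (hin ρ hρ).2
  obtain ⟨k, r, hr, hr0, hk⟩ := exists_x_pow_eq_coeffHom fun b =>
    (hL (x f σ * b)).mp ⟨b, rfl⟩ 1 (one_mem _)
  obtain ⟨s, rfl⟩ : ϖ ∣ r := by rwa [← Ideal.mem_span_singleton, ← hϖ]
  -- The norm of ϖ is invariant, hence central in A. It is a multiple of ϖ, so every value of f
  -- divides it, and it divides a power of x_σ.
  set z : S := ∏ τ : G, τ • ϖ with hz
  have hϖ0 : ϖ ≠ 0 := left_ne_zero_of_mul hr0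
  have hz0 : z ≠ 0 := Finset.prod_ne_zero_iff.mpr fun τ _ => (smul_ne_zero_iff_ne τ).mpr hϖ0
  have hz_inv : ∀ τ : G, τ • z = z := by
    intro τ
    rw [hz, Finset.smul_prod']
    exact Fintype.prod_equiv (Equiv.mulLeft τ) _ _ fun ρ => smul_smul _ _ _
  have hz_assoc : z ∣ ϖ ^ Fintype.card G := by
    rw [← Finset.card_univ, ← Finset.prod_const]
    exact Finset.prod_dvd_prod_of_dvd _ _ fun τ _ =>
      (associated_smul_of_maximalIdeal_eq_span hϖ τ).dvd
  obtain ⟨t, ht⟩ : z ∣ (ϖ * s) ^ Fintype.card G := by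
    rw [mul_pow]; exact hz_assoc.mul_right _
  have hϖz : ϖ ∣ z := by
    have := Finset.dvd_prod_of_mem (fun τ : G => τ • ϖ) (Finset.mem_univ 1)
    rwa [one_smul] at this
  have hxk : x f σ ^ (k * Fintype.card G) = coeffHom f z * coeffHom f t := by
    rw [pow_mul, hk, ← map_pow, ht, map_mul]
  have hcomm : ∀ a, ∃ b, a * x f σ = x f σ * b := fun a => (hL _).mpr ((hR _).mp ⟨a, rfl⟩)
  have hxN : ∀ n : N, x f σ • n = 0 → n = 0 := by
    intro n hn
    refine hN _ hr0 n ?_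
    have hk0 : k ≠ 0 := by
      rintro rfl
      rw [pow_zero, ← map_one (coeffHom f)] at hk
      have := congrFun hk 1
      rw [coeffHom_apply, coeffHom_apply, single_apply, single_apply, if_pos rfl, if_pos rfl]
        at this
      rw [← this] at hr
      exact (mem_maximalIdeal _).mp hr isUnit_one
    rw [← hk, ← Nat.sub_add_cancel (Nat.pos_of_ne_zero hk0), pow_succ, mul_smul, hn, smul_zero]
  -- The exponent is chosen so that x_σ to this power is z t: the k-th power is a multiple of ϖ, and
  -- z divides ϖ to the power |G|.
  obtain ⟨Q, hQ, hQp⟩ := exists_submodule_inf_ker_le_pow_smul hcomm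
    (fun Q T hT => isSemisimpleModule_of_x_smul_eq_zero hc hϖ (fun ρ hρ => (hout ρ hρ).1)
      (fun ρ hρ => (hin ρ hρ).1) _ hT) p hp hxN (k * Fintype.card G)
  obtain ⟨g, hg, hpg⟩ := exists_coeff_section hN (p ∘ₗ Q.subtype) fun n => by
    obtain ⟨q, hq, rfl⟩ := hQ n
    exact ⟨⟨q, hq⟩, rfl⟩
  obtain ⟨h, hh⟩ := exists_comp_eq_smul hz_inv
    (fun τ => (dvd_of_notMem_maximalIdeal_sq hϖ (hf _ _)).trans hϖz) hc _ g hg hpg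
  refine Module.Projective.of_comp_eq_smul (coeffHom_mul_comm f hz_inv)
    (fun m hm => funext fun i => coeffHom_mul_eq_zero hz0 (congrFun hm i)) (hN z hz0) p
    (Q.subtype ∘ₗ h) hh fun n => ?_
  obtain ⟨q, hq, rfl⟩ := hQ n
  -- Both h(p q) and z q lie in Q and have image z (p q) in N. Their difference is therefore z t l
  -- for some l, and h(p q) is divisible by z.
  obtain ⟨l, -, hl⟩ := hQp ((h (p q) : Fin n → f.CrossedProduct) - coeffHom f z • q)
    (Q.sub_mem (h (p q)).2 (Q.smul_mem _ hq)) (by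
      rw [map_sub, map_smul]
      exact sub_eq_zero.mpr (hh (p q)))
  refine ⟨q + coeffHom f t • l, ?_⟩
  rw [smul_add, smul_smul, ← hxk, ← hl]
  simp

end CrossedProduct

end NormalizedCocycle

namespace NormalizedCocycle

open IsLocalRing

variable {G S : Type*} [Group G] [CommRing S] [MulSemiringAction G S]

/-! ### The opposite cocycle -/

/-- The cocycle of the opposite ring of the crossed product, with respect to the basis
`x_{σ⁻¹}`. -/
def op (f : NormalizedCocycle G S) : NormalizedCocycle G S where
  toFun σ τ := (σ * τ) • f τ⁻¹ σ⁻¹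
  ne_zero' σ τ := (smul_ne_zero_iff_ne _).mpr (f.ne_zero' _ _)
  one_left' σ := by rw [inv_one, one_right, smul_one]
  one_right' σ := by rw [inv_one, one_left, smul_one]
  cocycle' σ τ γ := by
    have h := congrArg ((σ * τ * γ) • ·) (f.cocycle γ⁻¹ τ⁻¹ σ⁻¹)
    simp only [smul_mul', smul_smul] at h
    rw [show σ * τ * γ * γ⁻¹ = σ * τ by group] at h
    simp only [smul_smul, mul_inv_rev]
    rw [show σ * (τ * γ) = σ * τ * γ by group, ← h, mul_comm]

variable {f : NormalizedCocycle G S}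

theorem op_apply (σ τ : G) : f.op σ τ = (σ * τ) • f τ⁻¹ σ⁻¹ := rfl

namespace CrossedProduct

variable [DecidableEq G] [Fintype G]

variable (f) in
/-- The crossed product of the opposite cocycle is the opposite ring of the crossed product. -/
def opEquiv : f.op.CrossedProduct ≃+* f.CrossedProductᵐᵒᵖ where
  -- The basis element at σ goes to x_{σ⁻¹}, and its coefficient s moves to the right: x_{σ⁻¹} s =
  -- σ⁻¹(s) x_{σ⁻¹}.
  toFun a := MulOpposite.op fun σ => σ • a σ⁻¹
  invFun b := fun σ => σ • b.unop σ⁻¹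
  left_inv a := by
    ext σ
    change σ • σ⁻¹ • a σ⁻¹⁻¹ = a σ
    rw [smul_inv_smul, inv_inv]
  right_inv b := by
    apply MulOpposite.unop_injective
    ext σ
    change σ • σ⁻¹ • b.unop σ⁻¹⁻¹ = b.unop σ
    rw [smul_inv_smul, inv_inv]
  map_add' a b := by
    apply MulOpposite.unop_injective
    ext σ
    exact smul_add σ (a σ⁻¹) (b σ⁻¹)
  map_mul' a b := by
    apply MulOpposite.unop_injective
    ext γ
    change γ • (a * b) γ⁻¹ =
      ∑ ρ, (ρ • b ρ⁻¹) * ρ • ((ρ⁻¹ * γ) • a (ρ⁻¹ * γ)⁻¹) * f ρ (ρ⁻¹ * γ)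
    rw [mul_apply, Finset.smul_sum]
    refine Fintype.sum_equiv (Equiv.mulLeft γ) _ _ fun σ => ?_
    rw [Equiv.coe_mulLeft, op_apply]
    simp only [smul_mul', smul_smul, mul_inv_rev, mul_inv_cancel_left, mul_inv_cancel, one_smul,
      inv_mul_cancel_right, inv_inv]
    simp only [mul_assoc, mul_inv_cancel, mul_one]
    ring

theorem isSemihereditary_of_forall_notMem_sq [IsDomain S] [ValuationRing S] {c : S}
    (hc : ∑ σ : G, σ • c = 1) {ϖ : S} (hϖ : maximalIdeal S = Ideal.span {ϖ})
    (hf : ∀ σ τ, f σ τ ∉ maximalIdeal S ^ 2) : IsSemihereditary f.CrossedProduct := by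
  refine ⟨fun I hI => ?_, fun I hI => ?_⟩
  · have : Module.Finite f.CrossedProduct I := Module.Finite.iff_fg.mpr hI
    refine projective_of_forall_notMem_sq hc hϖ hf I fun s hs n hn => Subtype.ext ?_
    exact coeffHom_mul_eq_zero hs (congrArg Subtype.val hn)
  · have hfin : Module.Finite f.CrossedProductᵐᵒᵖ I := Module.Finite.iff_fg.mpr hI
    let e := opEquiv f
    have := RingHomInvPair.of_ringEquiv e
    have := RingHomInvPair.of_ringEquiv e.symm
    let : Module f.op.CrossedProduct I := Module.compHom I e.toRingHom
    let E : I ≃ₛₗ[(e : f.op.CrossedProduct →+* (f.CrossedProduct)ᵐᵒᵖ)] I :=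
      { AddEquiv.refl I with map_smul' := fun _ _ => rfl }
    have : Module.Finite f.op.CrossedProduct I :=
      Module.Finite.of_surjective E.symm.toLinearMap E.symm.surjective
    have : Module.Projective f.op.CrossedProduct I := by
      refine projective_of_forall_notMem_sq hc hϖ (fun σ τ h => ?_) I fun s hs n hn => ?_
      · have := smul_mem_maximalIdeal_sq h (σ * τ)⁻¹
        rw [op_apply, inv_smul_smul] at this
        exact hf _ _ this
      · refine Subtype.ext (CrossedProduct.ext fun σ => ?_)
        have h1 : (n : f.CrossedProduct) * (e (coeffHom f.op s)).unop = 0 :=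
          congrArg Subtype.val hn
        have h2 : (e (coeffHom f.op s)).unop = coeffHom f s := by
          ext τ
          change τ • (coeffHom f.op s) τ⁻¹ = coeffHom f s τ
          rw [coeffHom_apply, coeffHom_apply, single_apply, single_apply]
          by_cases hτ : τ = 1
          · simp [hτ]
          · simp [hτ]
        rw [h2] at h1
        have h3 := congrFun h1 σ
        rw [eq_sum_coeffHom_mul_x f (n : f.CrossedProduct), Finset.sum_mul] at h3
        simp only [mul_assoc, x, single_mul_coeffHom, coeffHom_mul_single] at h3
        rw [sum_apply, Finset.sum_eq_single σ (fun τ _ hτ => by simp [single_apply, hτ.symm])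
          (by simp), single_apply, if_pos rfl, one_mul] at h3
        exact (mul_eq_zero.mp h3).resolve_right ((smul_ne_zero_iff_ne σ).mpr hs)
    exact Module.Projective.of_equiv E

/-! ### The Jacobson radical -/

/-- An element with a power in `M A` is quasi-regular. -/
theorem exists_mul_one_add_eq_one [IsLocalRing S] {b : f.CrossedProduct} {k : ℕ}
    (hb : ∀ σ, (b ^ k) σ ∈ maximalIdeal S) : ∃ z, z * (1 + b) = 1 := by
  let : Module S f.CrossedProduct := Module.compHom _ (coeffHom f)
  have hfg : (⊤ : Submodule S f.CrossedProduct).FG := by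
    classical
    refine ⟨Finset.univ.image (x f), eq_top_iff.mpr fun a _ => ?_⟩
    rw [eq_sum_coeffHom_mul_x f a]
    refine Submodule.sum_mem _ fun σ _ => ?_
    exact Submodule.smul_mem _ (a σ) (Submodule.subset_span (by simp))
  set d : f.CrossedProduct := (-b) ^ k with hd
  have hdM : ∀ σ, d σ ∈ maximalIdeal S := by
    intro σ
    rw [hd, neg_pow]
    rcases neg_one_pow_eq_or f.CrossedProduct k with h | h <;> rw [h]
    · rw [one_mul]; exact hb σ
    · rw [neg_one_mul]; exact neg_mem (hb σ)
  let N : Submodule S f.CrossedProduct :=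
    { carrier := {a | ∃ z, a = z * (1 - d)}
      zero_mem' := ⟨0, (zero_mul _).symm⟩
      add_mem' := by
        rintro _ _ ⟨a, rfl⟩ ⟨b, rfl⟩
        exact ⟨a + b, (add_mul _ _ _).symm⟩
      smul_mem' := by
        rintro s _ ⟨a, rfl⟩
        exact ⟨s • a, (mul_assoc _ _ _).symm⟩ }
  -- Nakayama's lemma over S: A = A(1 - d) + MA, so 1 - d has a left inverse. A geometric sum then
  -- factors 1 - d through 1 + b.
  have hN : (⊤ : Submodule S f.CrossedProduct) ≤ N := by
    refine Submodule.le_of_le_smul_of_le_jacobson_bot hfg (maximalIdeal_le_jacobson ⊥)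
      fun a _ => ?_
    rw [show a = a * (1 - d) + a * d by rw [mul_sub, mul_one, sub_add_cancel]]
    refine Submodule.add_mem_sup ⟨a, rfl⟩ ?_
    rw [eq_sum_coeffHom_mul_x f (a * d)]
    refine Submodule.sum_mem _ fun σ _ =>
      Submodule.smul_mem_smul (r := (a * d) σ) ?_ (Submodule.mem_top (x := x f σ))
    rw [mul_apply]
    exact Ideal.sum_mem _ fun ρ _ => Ideal.mul_mem_right _ _
      (Ideal.mul_mem_left _ _ ((smul_mem_maximalIdeal_iff _ _).mpr (hdM _)))
  obtain ⟨z, hz⟩ := hN (Submodule.mem_top (x := 1))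
  refine ⟨z * ∑ i ∈ Finset.range k, (-b) ^ i, ?_⟩
  rw [mul_assoc, show (1 + b) = -(-b - 1) by abel, mul_neg, geom_sum_mul, neg_sub, ← hd, ← hz]

theorem mem_jacobson_of_forall_pow [IsLocalRing S] {a : f.CrossedProduct}
    (h : ∀ y : f.CrossedProduct, ∃ k : ℕ, ∀ σ, ((y * a) ^ k) σ ∈ maximalIdeal S) :
    a ∈ Ring.jacobson f.CrossedProduct := by
  rw [← Ideal.jacobson_bot, Ideal.mem_jacobson_iff]
  intro y
  obtain ⟨k, hk⟩ := h y
  obtain ⟨z, hz⟩ := exists_mul_one_add_eq_one hk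
  refine ⟨z, ?_⟩
  rw [Ideal.mem_bot, mul_assoc, ← hz]
  noncomm_ring

theorem coeffHom_mem_jacobson [IsLocalRing S] {s : S} (hs : s ∈ maximalIdeal S) :
    coeffHom f s ∈ Ring.jacobson f.CrossedProduct := by
  refine mem_jacobson_of_forall_pow fun y => ⟨1, fun σ => ?_⟩
  rw [pow_one, mul_apply]
  refine Ideal.sum_mem _ fun ρ _ => Ideal.mul_mem_right _ _
      (Ideal.mul_mem_left _ _ ((smul_mem_maximalIdeal_iff _ _).mpr ?_))
  rw [coeffHom_apply, single_apply]
  split_ifs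
  exacts [hs, zero_mem _]

theorem mul_pow_mem_range {A : Type*} [Monoid A] {y : A} (hy : ∀ a, ∃ b, a * y = y * b) (a : A)
    (k : ℕ) : ∃ b, (y * a) ^ k = y ^ k * b := by
  have hk : ∀ k : ℕ, ∀ a, ∃ b, a * y ^ k = y ^ k * b := by
    intro k
    induction k with
    | zero => exact fun a => ⟨a, by simp⟩
    | succ k ih =>
      intro a
      obtain ⟨b, hb⟩ := ih a
      obtain ⟨c, hc⟩ := hy b
      exact ⟨c, by rw [pow_succ, ← mul_assoc, hb, mul_assoc, hc, mul_assoc]⟩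
  induction k with
  | zero => exact ⟨1, by simp⟩
  | succ k ih =>
    obtain ⟨b, hb⟩ := ih
    obtain ⟨c, hc⟩ := hk k a
    exact ⟨c * b, by rw [pow_succ', hb, mul_assoc, ← mul_assoc a, hc, pow_succ']; group⟩

/-- The radical annihilates the semisimple module A / x_σ A, which gives one inclusion. Conversely,
x_σ is normal with a power in M, so every element of A x_σ A has a power in MA. -/
theorem jacobson_eq_range_x_mul [IsDomain S] [IsLocalRing S] {c : S}
    (hc : ∑ σ : G, σ • c = 1) {ϖ : S} (hϖ : maximalIdeal S = Ideal.span {ϖ}) {σ : G}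
    (hout : ∀ ρ, ρ ∉ f.unitSubgroup → IsUnit (f σ (σ⁻¹ * ρ)) ∧ IsUnit (f (ρ * σ⁻¹) σ))
    (hin : ∀ ρ, ρ ∈ f.unitSubgroup →
      Associated (f σ (σ⁻¹ * ρ)) ϖ ∧ Associated (f (ρ * σ⁻¹) σ) ϖ) :
    (Ring.jacobson f.CrossedProduct : Set f.CrossedProduct) = Set.range fun a => x f σ * a := by
  have hL := mem_range_x_mul_iff hϖ (fun ρ hρ => (hout ρ hρ).1) fun ρ hρ => (hin ρ hρ).1
  have hR := mem_range_mul_x_iff hϖ (fun ρ hρ => (hout ρ hρ).2) fun ρ hρ => (hin ρ hρ).2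
  have hcomm : ∀ a, ∃ b, a * x f σ = x f σ * b := fun a => (hL _).mpr ((hR _).mp ⟨a, rfl⟩)
  refine Set.Subset.antisymm (fun a ha => ?_) ?_
  · let T : Submodule f.CrossedProduct f.CrossedProduct :=
      { carrier := {a | ∃ b, a = x f σ * b}
        zero_mem' := ⟨0, (mul_zero _).symm⟩
        add_mem' := by
          rintro _ _ ⟨a, rfl⟩ ⟨b, rfl⟩
          exact ⟨a + b, (mul_add _ _ _).symm⟩
        smul_mem' := by
          rintro a _ ⟨b, rfl⟩
          obtain ⟨d, hd⟩ := hcomm a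
          exact ⟨d * b, by rw [smul_eq_mul, ← mul_assoc, hd, mul_assoc]⟩ }
    have : IsSemisimpleModule f.CrossedProduct (f.CrossedProduct ⧸ T) := by
      refine isSemisimpleModule_of_x_smul_eq_zero hc hϖ (fun ρ hρ => (hout ρ hρ).1)
        (fun ρ hρ => (hin ρ hρ).1) _ fun w => ?_
      obtain ⟨q, rfl⟩ := T.mkQ_surjective w
      rw [← map_smul, Submodule.mkQ_apply, Submodule.Quotient.mk_eq_zero]
      exact ⟨q, rfl⟩
    have h1 := IsSemisimpleModule.jacobson_le_annihilator f.CrossedProduct (f.CrossedProduct ⧸ T) ha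
    have h2 := Module.mem_annihilator.mp h1 (T.mkQ 1)
    rw [← map_smul, Submodule.mkQ_apply, Submodule.Quotient.mk_eq_zero, smul_eq_mul, mul_one] at h2
    obtain ⟨b, hb⟩ := h2
    exact ⟨b, hb.symm⟩
  · rintro _ ⟨a, rfl⟩
    obtain ⟨k, r, hr, -, hk⟩ := exists_x_pow_eq_coeffHom fun b =>
      (hL (x f σ * b)).mp ⟨b, rfl⟩ 1 (one_mem _)
    refine mem_jacobson_of_forall_pow fun y => ⟨k, fun τ => ?_⟩
    obtain ⟨b, hb⟩ := hcomm y
    obtain ⟨d, hd⟩ := mul_pow_mem_range hcomm (b * a) k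
    simp only [← mul_assoc] at hd ⊢
    rw [hb, hd, hk, coeffHom_mul_apply]
    exact Ideal.mul_mem_right _ _ hr

end CrossedProduct

end NormalizedCocycle

/-! ### Recovering the condition on cocycle values, and the equivalence -/

namespace NormalizedCocycle

open IsLocalRing

variable {G S : Type*} [Group G] [CommRing S] [IsLocalRing S] [MulSemiringAction G S]
  {f : NormalizedCocycle G S}

theorem notMem_sq_of_unitSubgroup_eq_top (hH : f.unitSubgroup = ⊤) (σ τ : G) :
    f σ τ ∉ maximalIdeal S ^ 2 := fun h =>
  (mem_maximalIdeal _).mp (Ideal.pow_le_self two_ne_zero h)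
    (f.isUnit_of_mem_right (hH ▸ Subgroup.mem_top τ) σ)

/-- If a value `f(σ⁻¹, σ)` lies outside `M²` and `f(κ, σ)` is a unit unless `κσ ∈ H`, then no
value of the cocycle lies in `M²`. -/
theorem notMem_sq_of_isUnit [Finite G] {σ : G} (hσ : σ ∉ f.unitSubgroup)
    (hsq : f σ⁻¹ σ ∉ maximalIdeal S ^ 2)
    (hunit : ∀ κ, κ * σ ∉ f.unitSubgroup → IsUnit (f κ σ)) (τ κ : G) :
    f τ κ ∉ maximalIdeal S ^ 2 := by
  classical
  refine f.notMem_sq_of_forall_inv (fun τ => ?_) τ κ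
  suffices h : f τ⁻¹ τ ∉ maximalIdeal S ^ 2 by
    intro hmem
    rw [apply_inv_self] at h
    exact h (smul_mem_maximalIdeal_sq hmem _)
  by_cases hτ : τ ∈ f.unitSubgroup
  · exact fun h => (mem_maximalIdeal _).mp (Ideal.pow_le_self two_ne_zero h)
      (f.isUnit_of_mem_right hτ _)
  -- If the sequence τσ⁻ⁱ never met H, every f(σ, σⁱ) would be a unit; taking σⁱ = σ⁻¹ contradicts σ
  -- ∉ H.
  have hex : ∃ k : ℕ, τ * (σ ^ k)⁻¹ ∈ f.unitSubgroup := by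
    by_contra! hcon
    have hpow : ∀ i : ℕ, IsUnit (f (τ * (σ ^ i)⁻¹) (σ ^ i)) ∧ IsUnit (f σ (σ ^ i)) := by
      intro i
      have step : ∀ i : ℕ, IsUnit (f (τ * (σ ^ i)⁻¹) (σ ^ i)) →
          IsUnit (f σ (σ ^ i)) ∧ IsUnit (f (τ * (σ ^ (i + 1))⁻¹) (σ ^ (i + 1))) := by
        intro i hi
        have h1 := f.cocycle (τ * (σ ^ (i + 1))⁻¹) σ (σ ^ i)
        have e : τ * (σ ^ (i + 1))⁻¹ * σ = τ * (σ ^ i)⁻¹ := by rw [pow_succ']; group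
        rw [e, ← pow_succ'] at h1
        have h2 := (hunit (τ * (σ ^ (i + 1))⁻¹) (e ▸ hcon i)).mul hi
        rw [← h1] at h2
        exact ⟨(isUnit_smul_iff_isUnit _ _).mp (isUnit_of_mul_isUnit_left h2),
          isUnit_of_mul_isUnit_right h2⟩
      have all : ∀ i : ℕ, IsUnit (f (τ * (σ ^ i)⁻¹) (σ ^ i)) := by
        intro i
        induction i with
        | zero => rw [pow_zero, one_right]; exact isUnit_one
        | succ i ih => exact (step i ih).2
      exact ⟨all i, (step i (all i)).1⟩
    have h1 := (hpow (orderOf σ - 1)).2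
    have h2 : σ ^ (orderOf σ - 1) = σ⁻¹ := by
      rw [eq_inv_iff_mul_eq_one, ← pow_succ, Nat.sub_add_cancel (orderOf_pos σ), pow_orderOf_eq_one]
    rw [h2] at h1
    exact hσ h1
  obtain ⟨k, hk, hmin⟩ : ∃ k : ℕ, τ * (σ ^ k)⁻¹ ∈ f.unitSubgroup ∧
      ∀ j < k, τ * (σ ^ j)⁻¹ ∉ f.unitSubgroup :=
    ⟨Nat.find hex, Nat.find_spec hex, fun j hj => Nat.find_min hex hj⟩
  have hk0 : k ≠ 0 := by
    rintro rfl
    exact hτ (by simpa using hk)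
  have hσj : ∀ j, 0 < j → j ≤ k → (σ ^ j)⁻¹ ∉ f.unitSubgroup := by
    intro j hj hjk hmem
    refine hmin (k - j) (by omega) ?_
    have h1 := mul_mem hk (inv_mem hmem)
    have h2 : (σ ^ k)⁻¹ = (σ ^ (k - j))⁻¹ * (σ ^ j)⁻¹ := by
      rw [← mul_inv_rev, ← pow_add, Nat.add_sub_cancel' hjk]
    rwa [h2, inv_inv, mul_assoc, inv_mul_cancel_right] at h1
  have step : ∀ j, f (τ⁻¹) (τ * (σ ^ (j + 1))⁻¹) * f (σ ^ (j + 1))⁻¹ σ =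
      τ⁻¹ • f (τ * (σ ^ (j + 1))⁻¹) σ * f τ⁻¹ (τ * (σ ^ j)⁻¹) := by
    intro j
    have h1 := f.cocycle τ⁻¹ (τ * (σ ^ (j + 1))⁻¹) σ
    rw [show τ * (σ ^ (j + 1))⁻¹ * σ = τ * (σ ^ j)⁻¹ by rw [pow_succ']; group,
      inv_mul_cancel_left] at h1
    exact h1.symm
  have hx : ∀ j : ℕ, ∀ g : G, g * (σ ^ (j + 1))⁻¹ * σ = g * (σ ^ j)⁻¹ := by
    intro j g
    rw [pow_succ']
    group
  -- Unitness of f(τ⁻¹, τσ⁻ʲ) is carried from j = k down to j = 1. The identity at j = 0 then makes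
  -- f(σ⁻¹, σ) a unit multiple of something divisible by f(τ⁻¹, τ).
  have hdown : ∀ i, i < k → IsUnit (f τ⁻¹ (τ * (σ ^ (k - i))⁻¹)) := by
    intro i
    induction i with
    | zero => exact fun _ => f.isUnit_of_mem_right hk _
    | succ i ih =>
      intro hi
      have h1 := step (k - (i + 1))
      rw [show k - (i + 1) + 1 = k - i by omega] at h1
      have h2 : IsUnit (f (σ ^ (k - i))⁻¹ σ) := by
        refine hunit _ ?_
        have := hx (k - (i + 1)) 1
        rw [one_mul, one_mul, show k - (i + 1) + 1 = k - i by omega] at this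
        rw [this]
        exact hσj _ (by omega) (by omega)
      have h3 := (ih (by omega)).mul h2
      rw [h1] at h3
      exact isUnit_of_mul_isUnit_right h3
  intro hmem
  have h1 := step 0
  have h2 := hdown (k - 1) (by omega)
  rw [show k - (k - 1) = 1 by omega] at h2
  rw [pow_zero, inv_one, mul_one, zero_add, pow_one] at h1
  rw [pow_one] at h2
  have h3 : f τ⁻¹ (τ * σ⁻¹) * f σ⁻¹ σ ∈ maximalIdeal S ^ 2 := h1 ▸ Ideal.mul_mem_left _ _ hmem
  exact hsq ((Ideal.unit_mul_mem_iff_mem _ h2).mp h3)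

variable [IsDomain S]

namespace CrossedProduct

variable [DecidableEq G] [Fintype G]

variable (f) in
/-- The left ideal of all elements whose coefficients at `H` lie in the maximal ideal. -/
def nonunitIdeal : Submodule f.CrossedProduct f.CrossedProduct where
  carrier := {a | ∀ h ∈ f.unitSubgroup, a h ∈ maximalIdeal S}
  zero_mem' _ _ := zero_mem _
  add_mem' ha hb h hh := add_mem (ha h hh) (hb h hh)
  smul_mem' a b hb h hh := by
    rw [smul_eq_mul, mul_apply]
    refine Ideal.sum_mem _ fun ρ _ => ?_
    by_cases hρ : ρ⁻¹ * h ∈ f.unitSubgroup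
    · exact Ideal.mul_mem_right _ _
        (Ideal.mul_mem_left _ _ ((smul_mem_maximalIdeal_iff _ _).mpr (hb _ hρ)))
    · refine Ideal.mul_mem_left _ _ ((mem_maximalIdeal _).mpr fun hu => hρ ?_)
      have h1 : IsUnit (f h (h⁻¹ * 1)) := by rw [mul_one]; exact hh
      have h2 := f.isUnit_trans hu h1
      rw [mul_one] at h2
      exact mul_mem (inv_mem (f.mem_unitSubgroup.mpr h2)) hh

theorem nonunitIdeal_fg {ϖ : S} (hϖ : maximalIdeal S = Ideal.span {ϖ}) :
    (nonunitIdeal f).FG := by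
  classical
  have hϖ_mem : ϖ ∈ maximalIdeal S := hϖ ▸ Ideal.mem_span_singleton_self ϖ
  refine ⟨insert (coeffHom f ϖ)
    ((Finset.univ.filter (· ∉ f.unitSubgroup)).image (x f)), le_antisymm ?_ fun a ha => ?_⟩
  · rw [Submodule.span_le]
    intro a ha
    simp only [Finset.coe_insert, Finset.coe_image, Set.mem_insert_iff, Set.mem_image,
      Finset.coe_filter, Finset.mem_univ, true_and, Set.mem_ofPred_eq] at ha
    rcases ha with rfl | ⟨τ, hτ, rfl⟩ <;> intro h hh
    · rw [coeffHom_apply, single_apply]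
      split_ifs
      exacts [hϖ_mem, zero_mem _]
    · rw [x, single_apply, if_neg fun e : h = τ => hτ (e ▸ hh)]
      exact zero_mem _
  · rw [eq_sum_coeffHom_mul_x f a]
    refine Submodule.sum_mem _ fun τ _ => ?_
    by_cases hτ : τ ∈ f.unitSubgroup
    · have h1 := ha τ hτ
      rw [hϖ, Ideal.mem_span_singleton] at h1
      obtain ⟨s, hs⟩ := (associated_smul_of_maximalIdeal_eq_span hϖ τ).dvd.trans h1
      rw [x, coeffHom_mul_single, mul_one, hs, mul_comm, ← single_mul_coeffHom]
      exact Submodule.smul_mem _ _ (Submodule.subset_span (by simp))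
    · exact Submodule.smul_mem _ _ (Submodule.subset_span (by
        simp only [Finset.coe_insert, Finset.coe_image, Set.mem_insert_iff, Set.mem_image,
          Finset.coe_filter, Finset.mem_univ, true_and, Set.mem_ofPred_eq]
        exact Or.inr ⟨τ, hτ, rfl⟩))

/-- If `nonunitIdeal f` is a projective left ideal, no value of the cocycle lies in `M²`. -/
theorem notMem_sq_of_projective {ϖ : S} (hϖ : maximalIdeal S = Ideal.span {ϖ})
    (hproj : Module.Projective f.CrossedProduct (nonunitIdeal f)) (σ τ : G) :
    f σ τ ∉ maximalIdeal S ^ 2 := by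
  by_cases hH : f.unitSubgroup = ⊤
  · exact notMem_sq_of_unitSubgroup_eq_top hH σ τ
  have hϖ_mem : ϖ ∈ maximalIdeal S := hϖ ▸ Ideal.mem_span_singleton_self ϖ
  obtain ⟨τ₀, hτ₀⟩ : ∃ τ, τ ∉ f.unitSubgroup := by
    by_contra! hcon
    exact hH (eq_top_iff.mpr fun x _ => hcon x)
  have hϖ0 : ϖ ≠ 0 := by
    rintro rfl
    have h1 : f τ₀ τ₀⁻¹ ∈ maximalIdeal S := (mem_maximalIdeal _).mpr hτ₀
    rw [hϖ, Ideal.mem_span_singleton, zero_dvd_iff] at h1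
    exact f.ne_zero' _ _ h1
  have hϖsq : ϖ ∉ maximalIdeal S ^ 2 := by
    intro h
    rw [hϖ, Ideal.span_singleton_pow, Ideal.mem_span_singleton, pow_two] at h
    have h1 : ϖ * ϖ ∣ ϖ * 1 := by rwa [mul_one]
    exact (mem_maximalIdeal _).mp hϖ_mem
      (isUnit_of_dvd_one ((mul_dvd_mul_iff_left hϖ0).mp h1))
  obtain ⟨s, hs⟩ := Module.projective_def'.mp hproj
  let p : nonunitIdeal f := ⟨coeffHom f ϖ, fun h hh => by
    rw [coeffHom_apply, single_apply]
    split_ifs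
    exacts [hϖ_mem, zero_mem _]⟩
  -- For τ outside H, x_τ lies in the ideal, so the section can be applied to x_τ ϖ = τ(ϖ) x_τ; its
  -- coordinates are multiples of τ(ϖ).
  have hcoef : ∀ i τ, τ ∉ f.unitSubgroup → ∀ ρ, τ • s p i ρ * f τ ρ ∈ maximalIdeal S := by
    intro i τ hτ ρ
    let y : nonunitIdeal f := ⟨x f τ, fun h hh => by
      rw [x, single_apply, if_neg fun e : h = τ => hτ (e ▸ hh)]
      exact zero_mem _⟩
    have h1 : x f τ • p = coeffHom f (τ • ϖ) • y := by
      refine Subtype.ext ?_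
      change x f τ * coeffHom f ϖ = coeffHom f (τ • ϖ) * x f τ
      rw [x, single_mul_coeffHom, coeffHom_mul_single, one_mul, mul_one]
    have h2 := congrArg (fun q => s q i) h1
    simp only [map_smul, Finsupp.smul_apply, smul_eq_mul] at h2
    have h3 := congrFun h2 (τ * ρ)
    rw [x_mul_apply, coeffHom_mul_apply, inv_mul_cancel_left] at h3
    rw [h3]
    exact Ideal.mul_mem_right _ _ ((smul_mem_maximalIdeal_iff _ _).mpr hϖ_mem)
  have hsum : ϖ = ∑ i ∈ (s p).support, ∑ ρ, s p i ρ * ρ • (i : f.CrossedProduct) (ρ⁻¹ * 1) *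
      f ρ (ρ⁻¹ * 1) := by
    have h1 := congrArg Subtype.val (LinearMap.congr_fun hs p)
    rw [LinearMap.comp_apply, Finsupp.linearCombination_apply, Finsupp.sum,
      AddSubmonoidClass.coe_finsetSum] at h1
    have h2 := congrFun h1 1
    rw [sum_apply] at h2
    refine Eq.trans ?_ h2.symm
    change ϖ = coeffHom f ϖ 1
    rw [coeffHom_apply, single_apply, if_pos rfl]
  -- The coefficient at 1 of the dual basis expansion is ϖ, which is outside M², so some term is
  -- too.
  obtain ⟨i, ρ, hiρ⟩ : ∃ i ρ, s p i ρ * ρ • (i : f.CrossedProduct) (ρ⁻¹ * 1) *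
      f ρ (ρ⁻¹ * 1) ∉ maximalIdeal S ^ 2 := by
    by_contra! hcon
    exact hϖsq (hsum ▸ Ideal.sum_mem _ fun i _ => Ideal.sum_mem _ fun ρ _ => hcon i ρ)
  rw [mul_one] at hiρ
  -- For ρ in H the ideal element contributes a factor in M, so the section's coefficient would be a
  -- unit, as is f(τ₀, ρ); this contradicts `hcoef`.
  have hρ : ρ ∉ f.unitSubgroup := by
    intro hρ
    have h1 : (i : f.CrossedProduct) ρ⁻¹ ∈ maximalIdeal S := i.2 _ (inv_mem hρ)
    have hb : s p i ρ ∉ maximalIdeal S := fun hb => hiρ (Ideal.mul_mem_right _ _ (by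
      rw [pow_two]
      exact Ideal.mul_mem_mul hb ((smul_mem_maximalIdeal_iff _ _).mpr h1)))
    rcases (maximalIdeal.isMaximal S).isPrime.mem_or_mem (hcoef i τ₀ hτ₀ ρ) with h | h
    · exact hb ((smul_mem_maximalIdeal_iff _ _).mp h)
    · exact (mem_maximalIdeal _).mp h (f.isUnit_of_mem_right hρ _)
  have hfρ : f ρ ρ⁻¹ ∈ maximalIdeal S := (mem_maximalIdeal _).mpr hρ
  have hb : s p i ρ ∉ maximalIdeal S := fun hb => hiρ (by
    rw [pow_two]
    exact Ideal.mul_mem_mul (Ideal.mul_mem_right _ _ hb) hfρ)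
  have hρsq : f ρ ρ⁻¹ ∉ maximalIdeal S ^ 2 := fun h => hiρ (Ideal.mul_mem_left _ _ h)
  have hmem : ∀ τ, τ ∉ f.unitSubgroup → f τ ρ ∈ maximalIdeal S := fun τ hτ =>
    ((maximalIdeal.isMaximal S).isPrime.mem_or_mem (hcoef i τ hτ ρ)).resolve_left
      fun h => hb ((smul_mem_maximalIdeal_iff _ _).mp h)
  -- A conjugate of f(ρ, ρ⁻¹) equals f(κρ⁻¹, ρ) f(κ, ρ⁻¹). It is outside M² and the first factor is
  -- in M, so the second is a unit.
  refine notMem_sq_of_isUnit (σ := ρ⁻¹) (fun h => hρ (inv_mem_iff.mp h)) (by rwa [inv_inv])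
    (fun κ hκ => ?_) σ τ
  by_contra hu
  have h1 := f.cocycle (κ * ρ⁻¹) ρ ρ⁻¹
  rw [mul_inv_cancel, one_right, mul_one, inv_mul_cancel_right] at h1
  have h2 : (κ * ρ⁻¹) • f ρ ρ⁻¹ ∈ maximalIdeal S ^ 2 := by
    rw [h1, pow_two]
    exact Ideal.mul_mem_mul (hmem _ hκ) ((mem_maximalIdeal _).mpr hu)
  have h3 := smul_mem_maximalIdeal_sq h2 (κ * ρ⁻¹)⁻¹
  rw [inv_smul_smul] at h3
  exact hρsq h3

theorem notMem_sq_of_jacobson_eq [hN : f.unitSubgroup.Normal] (hH : f.unitSubgroup ≠ ⊤) {σ : G}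
    (hgen : Subgroup.zpowers (σ : G ⧸ f.unitSubgroup) = ⊤)
    (hchain : ∀ i < Nat.card (G ⧸ f.unitSubgroup), ∀ j < Nat.card (G ⧸ f.unitSubgroup),
      ((σ ^ i : G) : G ⧸ f.unitSubgroup) ≤ ((σ ^ j : G) : G ⧸ f.unitSubgroup) ↔ i ≤ j)
    (hJ : (Ring.jacobson f.CrossedProduct : Set f.CrossedProduct) = Set.range fun a => x f σ * a)
    (τ κ : G) : f τ κ ∉ maximalIdeal S ^ 2 := by
  have hcard : Nat.card (G ⧸ f.unitSubgroup) = orderOf (σ : G ⧸ f.unitSubgroup) :=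
    (orderOf_eq_card_of_zpowers_eq_top hgen).symm
  rw [hcard] at hchain
  set m := orderOf (σ : G ⧸ f.unitSubgroup) with hm
  have hσ : σ ∉ f.unitSubgroup := by
    intro hσ
    rw [(QuotientGroup.eq_one_iff σ).mpr hσ, Subgroup.zpowers_one_eq_bot] at hgen
    refine hH (eq_top_iff.mpr fun g _ => (QuotientGroup.eq_one_iff g).mp ?_)
    rw [← Subgroup.mem_bot, hgen]
    exact Subgroup.mem_top _
  -- M lies in J(A) = x_σ A, and the coefficient of x_σ b at 1 is a multiple of f(σ, σ⁻¹).
  have hdvd : ∀ s ∈ maximalIdeal S, f σ σ⁻¹ ∣ s := by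
    intro s hs
    have h1 : coeffHom f s ∈ (Ring.jacobson f.CrossedProduct : Set f.CrossedProduct) :=
      coeffHom_mem_jacobson hs
    rw [hJ] at h1
    obtain ⟨b, hb⟩ := h1
    have h2 := congrFun hb 1
    simp only [x_mul_apply, mul_one, coeffHom_apply, single_apply, if_pos] at h2
    exact ⟨_, by rw [← h2, mul_comm]⟩
  have hu_mem : f σ σ⁻¹ ∈ maximalIdeal S := (mem_maximalIdeal _).mpr hσ
  have hu : f σ σ⁻¹ ∉ maximalIdeal S ^ 2 := by
    intro h
    have h1 : maximalIdeal S ≤ Ideal.span {f σ σ⁻¹} := fun s hs =>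
      Ideal.mem_span_singleton.mpr (hdvd s hs)
    have h2 := Ideal.pow_right_mono h1 2 h
    rw [Ideal.span_singleton_pow, Ideal.mem_span_singleton, pow_two] at h2
    have h3 : f σ σ⁻¹ * f σ σ⁻¹ ∣ f σ σ⁻¹ * 1 := by rwa [mul_one]
    exact hσ (isUnit_of_dvd_one ((mul_dvd_mul_iff_left (f.ne_zero' _ _)).mp h3))
  refine f.notMem_sq_of_forall_inv (fun τ hmem => ?_) τ κ
  by_cases hτ : τ ∈ f.unitSubgroup
  · exact (mem_maximalIdeal _).mp (Ideal.pow_le_self two_ne_zero hmem) hτ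
  have hτz : (τ : G ⧸ f.unitSubgroup) ∈ Subgroup.zpowers (σ : G ⧸ f.unitSubgroup) :=
    hgen ▸ Subgroup.mem_top _
  classical
  obtain ⟨i, hi, hiτ⟩ := Finset.mem_image.mp (mem_zpowers_iff_mem_range_orderOf.mp hτz)
  rw [Finset.mem_range, ← hm] at hi
  have hi0 : i ≠ 0 := by
    rintro rfl
    rw [pow_zero] at hiτ
    exact hτ ((QuotientGroup.eq_one_iff τ).mp hiτ.symm)
  have h1 : IsUnit (f σ (σ⁻¹ * τ)) := by
    rw [← graph_le_iff, ← hiτ]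
    have := (hchain 1 (by omega) i hi).mpr (by omega)
    rwa [pow_one] at this
  -- This is the chain relation between the classes of σⁱ⁻¹ and σᵐ⁻¹ = σ⁻¹.
  have h2 : IsUnit (f (σ⁻¹ * τ) τ⁻¹) := by
    have h3 : ((σ⁻¹ * τ : G) : G ⧸ f.unitSubgroup) ≤ ((σ⁻¹ : G) : G ⧸ f.unitSubgroup) := by
      have e1 : ((σ⁻¹ * τ : G) : G ⧸ f.unitSubgroup) =
          ((σ ^ (i - 1) : G) : G ⧸ f.unitSubgroup) := by
        rw [QuotientGroup.mk_mul, ← hiτ, QuotientGroup.mk_inv, QuotientGroup.mk_pow,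
          inv_mul_eq_iff_eq_mul, ← pow_succ', Nat.sub_add_cancel (by omega)]
      have e2 : ((σ⁻¹ : G) : G ⧸ f.unitSubgroup) = ((σ ^ (m - 1) : G) : G ⧸ f.unitSubgroup) := by
        rw [QuotientGroup.mk_inv, QuotientGroup.mk_pow, inv_eq_iff_mul_eq_one, ← pow_succ',
          Nat.sub_add_cancel (by omega), hm, pow_orderOf_eq_one]
      rw [e1, e2]
      exact (hchain _ (by omega) _ (by omega)).mpr (by omega)
    rw [graph_le_iff] at h3
    rwa [show (σ⁻¹ * τ)⁻¹ * σ⁻¹ = τ⁻¹ by group] at h3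
  have h4 := f.cocycle σ (σ⁻¹ * τ) τ⁻¹
  rw [mul_inv_cancel_left, mul_assoc, mul_inv_cancel, mul_one] at h4
  have h5 : σ • f (σ⁻¹ * τ) τ⁻¹ * f σ σ⁻¹ ∈ maximalIdeal S ^ 2 :=
    h4 ▸ Ideal.mul_mem_left _ _ hmem
  exact hu ((Ideal.unit_mul_mem_iff_mem _ ((isUnit_smul_iff_isUnit _ _).mpr h2)).mp h5)

end CrossedProduct

open CrossedProduct in
/-- The equivalence over a valuation ring with principal maximal ideal on which a finite group
acts with surjective trace. -/
theorem tfae_isSemihereditary {S : Type*} [CommRing S] [IsDomain S] [ValuationRing S]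
    [MulSemiringAction G S] [DecidableEq G] [Fintype G] (f : NormalizedCocycle G S) {c : S}
    (hc : ∑ σ : G, σ • c = 1) {ϖ : S} (hϖ : maximalIdeal S = Ideal.span {ϖ}) :
    List.TFAE [
      IsSemihereditary f.CrossedProduct,
      ∀ σ τ : G, f σ τ ∉ Ring.jacobson S ^ 2,
      ∃ _ : f.unitSubgroup.Normal,
        IsCyclic (G ⧸ f.unitSubgroup) ∧
        (f.unitSubgroup = ⊤ ∨
          ∃ σ : G,
            Subgroup.zpowers (σ : G ⧸ f.unitSubgroup) = ⊤ ∧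
            (∀ i < Nat.card (G ⧸ f.unitSubgroup), ∀ j < Nat.card (G ⧸ f.unitSubgroup),
                ((σ ^ i : G) : G ⧸ f.unitSubgroup) ≤ ((σ ^ j : G) : G ⧸ f.unitSubgroup) ↔ i ≤ j) ∧
            (Ring.jacobson f.CrossedProduct : Set f.CrossedProduct) =
              Set.range fun a : f.CrossedProduct => x f σ * a)] := by
  rw [IsLocalRing.ringJacobson_eq_maximalIdeal]
  tfae_have 1 → 2 := fun h => notMem_sq_of_projective hϖ (h.1 _ (nonunitIdeal_fg hϖ))
  tfae_have 2 → 1 := fun h => isSemihereditary_of_forall_notMem_sq hc hϖ h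
  tfae_have 3 → 2 := by
    rintro ⟨hN, -, hH | ⟨σ, hgen, hchain, hJ⟩⟩
    · exact notMem_sq_of_unitSubgroup_eq_top hH
    · by_cases hH : f.unitSubgroup = ⊤
      · exact notMem_sq_of_unitSubgroup_eq_top hH
      · exact notMem_sq_of_jacobson_eq hH hgen hchain hJ
  tfae_have 2 → 3 := by
    intro h
    by_cases hH : f.unitSubgroup = ⊤
    · have hN : f.unitSubgroup.Normal := hH ▸ inferInstance
      have hsub : Subsingleton (G ⧸ f.unitSubgroup) := by
        refine ⟨fun a b => ?_⟩
        induction a using QuotientGroup.induction_on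
        induction b using QuotientGroup.induction_on
        exact QuotientGroup.eq.mpr (hH ▸ Subgroup.mem_top _)
      exact ⟨hN, isCyclic_of_subsingleton, Or.inl hH⟩
    · obtain ⟨hN, σ, hσ, hout, hin, hpow, hchain⟩ := f.exists_generator hϖ h hH
      have hgen : Subgroup.zpowers (σ : G ⧸ f.unitSubgroup) = ⊤ := by
        refine eq_top_iff.mpr fun q _ => ?_
        induction q using QuotientGroup.induction_on with | H τ => ?_
        obtain ⟨i, hi⟩ := hpow τ
        rw [← QuotientGroup.eq.mpr hi, QuotientGroup.mk_pow]
        exact Subgroup.npow_mem_zpowers _ _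
      refine ⟨hN, ⟨σ, fun q => (by rw [hgen]; trivial : q ∈ Subgroup.zpowers _)⟩,
        Or.inr ⟨σ, hgen, fun i hi j hj => ?_, jacobson_eq_range_x_mul hc hϖ hout hin⟩⟩
      rw [← orderOf_eq_card_of_zpowers_eq_top hgen] at hi hj
      rw [graph_le_iff]
      refine hchain _ (fun k hk0 hk hmem => ?_) i hi j hj
      refine pow_ne_one_of_lt_orderOf hk0.ne' hk ?_
      rw [← QuotientGroup.mk_pow]
      exact (QuotientGroup.eq_one_iff _).mpr hmem
  tfae_finish

end NormalizedCocycle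

open IsLocalRing

/-! ### Surjectivity of the trace -/

theorem sum_comp_eq_card_ker_smul {G H M : Type*} [Group G] [Fintype G] [Group H] [Fintype H]
    [AddCommMonoid M] (φ : G →* H) (hφ : Function.Surjective φ) (F : H → M) :
    ∑ g, F (φ g) = Nat.card φ.ker • ∑ h, F h := by
  classical
  have hker : ∀ h, (Finset.univ.filter fun g => φ g = h).card = Nat.card φ.ker := by
    intro h
    rw [MonoidHom.card_fiber_eq_of_mem_range φ (hφ h) (hφ 1), Nat.card_eq_fintype_card,
      Fintype.card_subtype]
    congr 1
    ext g
    simp [MonoidHom.mem_ker]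
  rw [← Finset.sum_fiberwise Finset.univ φ, Finset.smul_sum]
  refine Finset.sum_congr rfl fun h _ => ?_
  rw [Finset.sum_congr rfl fun g hg => by rw [(Finset.mem_filter.mp hg).2], Finset.sum_const, hker]

open scoped Pointwise in
attribute [local instance] Ideal.Quotient.field in
/-- If the residue extension of an invariant extension of local rings is separable and the
inertia group has order invertible in the residue field, the trace is surjective. -/
theorem exists_sum_smul_eq_one {A B G : Type*} [CommRing A] [CommRing B] [Algebra A B]
    [IsLocalRing A] [IsLocalRing B] [Group G] [Fintype G] [MulSemiringAction G B]
    [SMulCommClass G A B] [Algebra.IsInvariant A B G]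
    [(maximalIdeal B).LiesOver (maximalIdeal A)]
    [Algebra.IsSeparable (A ⧸ maximalIdeal A) (B ⧸ maximalIdeal B)] {e : ℕ}
    (hcard : Fintype.card G = e * Module.finrank (A ⧸ maximalIdeal A) (B ⧸ maximalIdeal B))
    (he : (e : A ⧸ maximalIdeal A) ≠ 0) : ∃ c : B, ∑ σ : G, σ • c = 1 := by
  classical
  -- A `finrank` of 0 would stand for infinite residue degree; the degree formula excludes it.
  have hfr : 0 < Module.finrank (A ⧸ maximalIdeal A) (B ⧸ maximalIdeal B) := by
    rw [Nat.pos_iff_ne_zero]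
    intro h0
    rw [h0, mul_zero] at hcard
    exact Fintype.card_ne_zero hcard
  have : FiniteDimensional (A ⧸ maximalIdeal A) (B ⧸ maximalIdeal B) :=
    FiniteDimensional.of_finrank_pos hfr
  have : Normal (A ⧸ maximalIdeal A) (B ⧸ maximalIdeal B) := Ideal.Quotient.normal G _ _
  have : IsGalois (A ⧸ maximalIdeal A) (B ⧸ maximalIdeal B) := {}
  set φ := Ideal.Quotient.stabilizerHom (maximalIdeal B) (maximalIdeal A) G with hφ
  have hsurj : Function.Surjective φ := Ideal.Quotient.stabilizerHom_surjective G _ _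
  have hstab : MulAction.stabilizer G (maximalIdeal B) = ⊤ := by
    refine eq_top_iff.mpr fun σ _ => MulAction.mem_stabilizer_iff.mpr ?_
    ext s
    rw [Ideal.mem_pointwise_smul_iff_inv_smul_mem, smul_mem_maximalIdeal_iff]
  -- G fixes the maximal ideal and maps onto the residue Galois group, so the degree formula leaves
  -- order e for the inertia group.
  have hker : Nat.card φ.ker = e := by
    have h2 : Nat.card (MulAction.stabilizer G (maximalIdeal B)) = Fintype.card G := by
      rw [hstab, Subgroup.card_top, Nat.card_eq_fintype_card]
    have h1 := φ.ker.card_eq_card_quotient_mul_card_subgroup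
    rw [Nat.card_congr (QuotientGroup.quotientKerEquivOfSurjective φ hsurj).toEquiv,
      IsGalois.card_aut_eq_finrank, h2, hcard, mul_comm] at h1
    exact (Nat.eq_of_mul_eq_mul_left hfr h1).symm
  obtain ⟨t, ht⟩ := Algebra.trace_surjective (A ⧸ maximalIdeal A) (B ⧸ maximalIdeal B) 1
  obtain ⟨c, rfl⟩ := Ideal.Quotient.mk_surjective t
  -- Each residue automorphism is hit e times, so the G-sum reduces to e times the residue trace of
  -- c, which is 1.
  have hsum : Ideal.Quotient.mk (maximalIdeal B) (∑ σ : G, σ • c) =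
      algebraMap (A ⧸ maximalIdeal A) (B ⧸ maximalIdeal B) e := by
    have h1 := sum_comp_eq_card_ker_smul φ hsurj
      fun α => α (Ideal.Quotient.mk (maximalIdeal B) c)
    rw [hker, ← trace_eq_sum_automorphisms, ht, map_one, nsmul_one] at h1
    rw [map_natCast, ← h1, map_sum]
    let E : MulAction.stabilizer G (maximalIdeal B) ≃ G :=
      (Equiv.subtypeUnivEquiv fun σ => hstab ▸ Subgroup.mem_top σ)
    exact (Fintype.sum_equiv E _ _ fun σ => rfl).symm
  have hunit : IsUnit (∑ σ : G, σ • c) := by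
    by_contra hu
    have h1 : Ideal.Quotient.mk (maximalIdeal B) (∑ σ : G, σ • c) = 0 :=
      Ideal.Quotient.eq_zero_iff_mem.mpr ((mem_maximalIdeal _).mpr hu)
    rw [hsum] at h1
    exact he ((map_eq_zero _).mp h1)
  obtain ⟨u, hu⟩ := hunit
  have hinv : ∀ σ : G, σ • (u : B) = u := by
    intro σ
    rw [hu, Finset.smul_sum]
    exact Fintype.sum_equiv (Equiv.mulLeft σ) _ _ fun τ => smul_smul _ _ _
  have hinv' : ∀ σ : G, σ • (↑u⁻¹ : B) = ↑u⁻¹ := by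
    intro σ
    have h1 : u * σ • (↑u⁻¹ : B) = 1 := by
      conv_lhs => rw [← hinv σ, ← smul_mul', Units.mul_inv, smul_one]
    exact (Units.eq_inv_of_mul_eq_one_left h1)
  refine ⟨c * ↑u⁻¹, ?_⟩
  simp only [smul_mul', hinv']
  rw [← Finset.sum_mul, ← hu, Units.mul_inv]

/-! ### The maximal ideal of an invariant extension of valuation rings -/

/-- If z divides τz, iterating over the finite order of τ returns to z and gives τz | z. In a
valuation ring this holds for σ or for σ⁻¹. -/
theorem ValuationRing.associated_smul {G B : Type*} [Group G] [Finite G] [CommRing B] [IsDomain B]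
    [ValuationRing B] [MulSemiringAction G B] (σ : G) (z : B) : Associated (σ • z) z := by
  have hd : ∀ (τ : G) (a b : B), a ∣ b → τ • a ∣ τ • b := fun τ a b h =>
    map_dvd (MulSemiringAction.toRingHom G B τ) h
  have key : ∀ τ : G, z ∣ τ • z → Associated (τ • z) z := by
    intro τ h
    have hpow : ∀ i : ℕ, τ • z ∣ τ ^ (i + 1) • z := by
      intro i
      induction i with
      | zero => simp
      | succ i ih =>
        rw [pow_succ, mul_smul]
        exact ih.trans (hd _ _ _ h)
    have h1 := hpow (orderOf τ - 1)
    rw [Nat.sub_add_cancel (orderOf_pos τ), pow_orderOf_eq_one, one_smul] at h1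
    exact associated_of_dvd_dvd h1 h
  rcases ValuationRing.dvd_total z (σ • z) with h | h
  · exact key σ h
  · have h1 := hd σ⁻¹ _ _ h
    rw [inv_smul_smul] at h1
    have h2 := key σ⁻¹ h1
    exact associated_of_dvd_dvd h (by simpa using hd σ _ _ h2.dvd)

/-- If the maximal ideal is not principal, each of its elements is a product of two others in it.
Repeated factoring makes every power of p divide pⁿ, which is absurd. -/
theorem ValuationRing.exists_maximalIdeal_eq_span {B : Type*} [CommRing B] [IsDomain B]
    [ValuationRing B] {p : B} (hp0 : p ≠ 0) (hp : p ∈ maximalIdeal B) {n : ℕ}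
    (h : ∀ z ∈ maximalIdeal B, p ∣ z ^ n) : ∃ ϖ, maximalIdeal B = Ideal.span {ϖ} := by
  by_contra! hcon
  have hfac : ∀ y ∈ maximalIdeal B, ∃ a ∈ maximalIdeal B, ∃ b ∈ maximalIdeal B, y = a * b := by
    intro y hy
    obtain ⟨z, hz, hyz⟩ : ∃ z ∈ maximalIdeal B, ¬ y ∣ z := by
      by_contra! hall
      refine hcon y (le_antisymm (fun z hz => Ideal.mem_span_singleton.mpr (hall z hz)) ?_)
      rwa [Ideal.span_singleton_le_iff_mem]
    obtain ⟨b, rfl⟩ := (ValuationRing.dvd_total y z).resolve_left hyz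
    refine ⟨z, hz, b, (mem_maximalIdeal b).mpr fun hb => hyz ?_, rfl⟩
    exact hb.mul_right_dvd.mpr dvd_rfl
  have hpow : ∀ k : ℕ, ∀ y ∈ maximalIdeal B, p ^ k ∣ y ^ n := by
    intro k
    induction k with
    | zero => exact fun y _ => by rw [pow_zero]; exact one_dvd _
    | succ k ih =>
      intro y hy
      obtain ⟨a, ha, b, hb, rfl⟩ := hfac y hy
      rw [pow_succ, mul_pow]
      exact mul_dvd_mul (ih a ha) (h b hb)
  have h1 := hpow (n + 1) p hp
  have h2 := (pow_dvd_pow_iff hp0 ((mem_maximalIdeal p).mp hp)).mp h1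
  omega

/-- The norm of z comes from the maximal ideal (p) of A and is an associate of z to the power |G|,
so p divides that power. If p maps to 0, the maximal ideal of B is zero. -/
theorem exists_maximalIdeal_eq_span_of_isInvariant {A B G : Type*} [CommRing A] [IsLocalRing A]
    [CommRing B] [IsDomain B] [ValuationRing B] [Algebra A B] [Group G] [Finite G]
    [MulSemiringAction G B] [Algebra.IsInvariant A B G]
    [(maximalIdeal B).LiesOver (maximalIdeal A)]
    (hA : (maximalIdeal A).IsPrincipal) : ∃ ϖ, maximalIdeal B = Ideal.span {ϖ} := by
  obtain ⟨p, hp⟩ := hA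
  have := Fintype.ofFinite G
  have hdvd : ∀ z ∈ maximalIdeal B, algebraMap A B p ∣ z ^ Fintype.card G := by
    intro z hz
    obtain ⟨v, hv⟩ := Algebra.IsInvariant.isInvariant (A := A) (G := G) (∏ σ : G, σ • z) (by
      intro τ
      rw [Finset.smul_prod']
      exact Fintype.prod_equiv (Equiv.mulLeft τ) _ _ fun σ => smul_smul _ _ _)
    have h1 : Associated (∏ σ : G, σ • z) (z ^ Fintype.card G) := by
      rw [← Finset.card_univ, ← Finset.prod_const]
      exact Associated.prod _ _ _ fun σ _ => ValuationRing.associated_smul σ z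
    have hvm : v ∈ maximalIdeal A := by
      rw [Ideal.LiesOver.over (P := maximalIdeal B) (p := maximalIdeal A), Ideal.mem_comap, hv]
      have h2 : z ∣ ∏ σ : G, σ • z := by
        have := Finset.dvd_prod_of_mem (fun σ : G => σ • z) (Finset.mem_univ 1)
        rwa [one_smul] at this
      exact Ideal.mem_of_dvd _ h2 hz
    rw [hp] at hvm
    obtain ⟨a, rfl⟩ := Ideal.mem_span_singleton.mp hvm
    refine dvd_trans ?_ h1.dvd
    rw [← hv, map_mul]
    exact dvd_mul_right _ _
  by_cases hp0 : algebraMap A B p = 0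
  · refine ⟨0, ?_⟩
    rw [Ideal.span_singleton_zero, eq_bot_iff]
    intro z hz
    have h1 := hdvd z hz
    rw [hp0, zero_dvd_iff] at h1
    exact (pow_eq_zero_iff Fintype.card_ne_zero).mp h1
  · refine ValuationRing.exists_maximalIdeal_eq_span hp0 ?_ hdvd
    have h1 : p ∈ maximalIdeal A := hp ▸ Ideal.mem_span_singleton_self p
    rw [Ideal.LiesOver.over (P := maximalIdeal B) (p := maximalIdeal A), Ideal.mem_comap] at h1
    exact h1

/-! ### Indecomposed Galois extensions of valuation rings -/

section Galois

variable (V F K : Type*) [CommRing V] [Field F] [Algebra V F] [Field K] [Algebra F K] [Algebra V K]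
  [IsScalarTower V F K] [FiniteDimensional F K] [IsGalois F K]

theorem isInvariant_integralClosure [IsDomain V] [IsIntegrallyClosed V] [IsFractionRing V F] :
    Algebra.IsInvariant V (integralClosure V K) Gal(K/F) := by
  refine ⟨fun b hb => ?_⟩
  obtain ⟨y, hy⟩ := (IsGalois.mem_range_algebraMap_iff_fixed (F := F) (b : K)).mpr
    fun σ => congrArg Subtype.val (hb σ)
  have hint : IsIntegral V y := by
    rw [← isIntegral_algebraMap_iff (FaithfulSMul.algebraMap_injective F K), hy]
    exact b.2
  obtain ⟨a, rfl⟩ := IsIntegrallyClosed.algebraMap_eq_of_integral hint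
  refine ⟨a, Subtype.ext ?_⟩
  rw [← hy, ← IsScalarTower.algebraMap_apply]
  rfl

variable {V F K}

theorem IsIndecomposed.exists_valuationSubring (h : IsIndecomposed V F K) :
    ∃ W : ValuationSubring K, ∀ x ∈ W, IsIntegral V x := by
  obtain ⟨W, hW, huniq⟩ := h
  refine ⟨W, fun x hx => ?_⟩
  have hσ : ∀ σ : Gal(K/F), σ x ∈ W := by
    intro σ
    -- σ fixes F, so the conjugate ring also lies over V, and uniqueness applies.
    have h1 : W.comap (σ : K →+* K) = W := by
      refine huniq _ ?_
      simp only at hW ⊢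
      rw [← hW]
      ext y
      change σ (algebraMap F K y) ∈ W ↔ algebraMap F K y ∈ W
      rw [AlgEquiv.commutes]
    have h2 : x ∈ W.comap (σ : K →+* K) := h1.symm ▸ hx
    exact h2
  set p := MulSemiringAction.charpoly Gal(K/F) x with hp
  have hpW : p ∈ Polynomial.lifts W.toSubring.subtype := by
    rw [hp, MulSemiringAction.charpoly_eq]
    refine Subsemiring.prod_mem _ fun σ _ => ?_
    rw [Polynomial.lifts_iff_liftsRing]
    refine sub_mem ?_ ?_ <;> rw [← Polynomial.lifts_iff_liftsRing]
    · exact Polynomial.X_mem_lifts _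
    · exact Polynomial.C_mem_lifts W.toSubring.subtype ⟨σ x, hσ σ⟩
  -- The coefficients are fixed by the Galois group and lie in W, so they lie in W ∩ F = V.
  have hpV : p ∈ Polynomial.lifts (algebraMap V K) := by
    rw [Polynomial.lifts_iff_coeff_lifts] at hpW ⊢
    intro n
    obtain ⟨⟨w, hw⟩, hwn⟩ := hpW n
    obtain ⟨y, hy⟩ := (IsGalois.mem_range_algebraMap_iff_fixed (F := F) (p.coeff n)).mpr
      fun σ => MulSemiringAction.smul_coeff_charpoly x n σ
    have h1 : y ∈ W.toSubring.comap (algebraMap F K) := by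
      change algebraMap F K y ∈ W
      rw [hy, ← hwn]
      exact hw
    rw [hW] at h1
    obtain ⟨v, rfl⟩ := h1
    exact ⟨v, by rw [← hy, ← IsScalarTower.algebraMap_apply]⟩
  obtain ⟨q, hq, -, hqm⟩ := Polynomial.lifts_and_natDegree_eq_and_monic hpV
    (MulSemiringAction.monic_charpoly _ x)
  refine ⟨q, hqm, ?_⟩
  rw [← Polynomial.eval_map, hq, hp, MulSemiringAction.eval_charpoly]

theorem IsIndecomposed.valuationRing (h : IsIndecomposed V F K) :
    ValuationRing (integralClosure V K) := by
  obtain ⟨W, hW⟩ := h.exists_valuationSubring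
  refine { cond' := fun a b => ?_ }
  by_cases ha : a = 0
  · exact ⟨0, Or.inr (by rw [ha, mul_zero])⟩
  by_cases hb : b = 0
  · exact ⟨0, Or.inl (by rw [hb, mul_zero])⟩
  have ha' : (a : K) ≠ 0 := fun h => ha (Subtype.ext h)
  have hb' : (b : K) ≠ 0 := fun h => hb (Subtype.ext h)
  rcases W.mem_or_inv_mem ((b : K) / a) with h | h
  · refine ⟨⟨_, hW _ h⟩, Or.inl (Subtype.ext ?_)⟩
    change (a : K) * (b / a) = b
    field_simp
  · refine ⟨⟨_, hW _ h⟩, Or.inr (Subtype.ext ?_)⟩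
    change (b : K) * ((b / a : K)⁻¹) = a
    field_simp

end Galois

/-! ### Localization and residue field of a local integral closure -/

section Local

variable (V K : Type*) [CommRing V] [Field K] [Algebra V K] [IsLocalRing (integralClosure V K)]

/-- If the integral closure is local, it coincides with its localization. -/
noncomputable def integralClosureEquivLocAt :
    integralClosure V K ≃ₐ[V] locAt (maximalIdeal (integralClosure V K)) :=
  AlgEquiv.ofBijective
    { toFun := fun s => ⟨s, s, 1, fun h => (Ideal.ne_top_iff_one _).mp Ideal.IsPrime.ne_top' h,
        by simp⟩
      map_one' := rfl
      map_mul' := fun _ _ => rfl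
      map_zero' := rfl
      map_add' := fun _ _ => rfl
      commutes' := fun _ => rfl } <| by
    refine ⟨fun a b h => Subtype.ext
      (congrArg (fun z : locAt (maximalIdeal (integralClosure V K)) => (z : K)) h), ?_⟩
    rintro ⟨_, a, s, hs, rfl⟩
    obtain ⟨u, rfl⟩ : IsUnit s := by
      by_contra hu
      exact hs ((mem_maximalIdeal s).mpr hu)
    refine ⟨a * ↑u⁻¹, Subtype.ext ?_⟩
    have h1 := coe_ne_zero_of_notMem hs
    have h2 : ((u : integralClosure V K) : K) * ((↑u⁻¹ : integralClosure V K) : K) = 1 := by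
      have := congrArg Subtype.val (Units.mul_inv u)
      exact this
    change (a : K) * ((↑u⁻¹ : integralClosure V K) : K) = a / (u : integralClosure V K)
    rw [eq_div_iff h1, mul_assoc, mul_comm ((↑u⁻¹ : integralClosure V K) : K), h2, mul_one]

end Local

open IsLocalRing

section ResidueField

variable (V F K : Type*) [CommRing V] [IsLocalRing V] [Field F] [Field K] [Algebra V F]
  [Algebra F K] [Algebra V K] [IsScalarTower V F K]

instance liesOver_integralClosure [IsLocalRing (integralClosure V K)] :
    (maximalIdeal (integralClosure V K)).LiesOver (maximalIdeal V) :=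
  ⟨(IsLocalRing.eq_maximalIdeal
    (Ideal.isMaximal_comap_of_isIntegral_of_isMaximal (R := V) _)).symm⟩

variable [IsLocalRing (integralClosure V K)]

theorem mapEquiv_algebraMap_quotient (t : V ⧸ maximalIdeal V) :
    ResidueField.mapEquiv (integralClosureEquivLocAt V K).toRingEquiv
        (algebraMap (V ⧸ maximalIdeal V)
          (integralClosure V K ⧸ maximalIdeal (integralClosure V K)) t) =
      algebraMap (ResidueField V)
        (ResidueField (locAt (maximalIdeal (integralClosure V K)))) t := by
  obtain ⟨v, rfl⟩ := Ideal.Quotient.mk_surjective t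
  rfl

attribute [local instance] Ideal.Quotient.field in
theorem IsTamelyRamified.isSeparable_quotient (h : IsTamelyRamified V F K) :
    Algebra.IsSeparable (V ⧸ maximalIdeal V)
      (integralClosure V K ⧸ maximalIdeal (integralClosure V K)) := by
  have h1 := (h (maximalIdeal (integralClosure V K))).2
  let e := ResidueField.mapEquiv (integralClosureEquivLocAt V K).toRingEquiv
  refine Algebra.IsSeparable.of_equiv_equiv (A₁ := ResidueField V)
    (B₁ := ResidueField (locAt (maximalIdeal (integralClosure V K))))
    (RingEquiv.refl (V ⧸ maximalIdeal V)) e.symm ?_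
  refine RingHom.ext fun t => e.injective ?_
  refine Eq.trans ?_ (e.apply_symm_apply _).symm
  exact mapEquiv_algebraMap_quotient V K t

theorem finrank_quotient_eq :
    Module.finrank (V ⧸ maximalIdeal V)
      (integralClosure V K ⧸ maximalIdeal (integralClosure V K)) =
    Module.finrank (ResidueField V)
      (ResidueField (locAt (maximalIdeal (integralClosure V K)))) :=
  Algebra.finrank_eq_of_equiv_equiv (RingEquiv.refl (V ⧸ maximalIdeal V))
    (ResidueField.mapEquiv (integralClosureEquivLocAt V K).toRingEquiv)
    (RingHom.ext fun t => (mapEquiv_algebraMap_quotient V K t).symm)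

end ResidueField

theorem theorem3p2
    (V F K : Type*) [CommRing V] [IsDomain V] [ValuationRing V]
    [Field F] [Algebra V F] [IsFractionRing V F]
    [Field K] [Algebra F K] [Algebra V K] [IsScalarTower V F K]
    [FiniteDimensional F K] [IsGalois F K] [DecidableEq Gal(K/F)]
    (f : NormalizedCocycle Gal(K/F) (integralClosure V K))
    (htame : IsTamelyRamified V F K) (hdefectless : IsDefectless V F K)
    (hprincipal : (Ring.jacobson V).IsPrincipal)
    (hindecomposed : IsIndecomposed V F K) :
    List.TFAE [
      IsSemihereditary f.CrossedProduct,
      ∀ σ τ : Gal(K/F), f σ τ ∉ Ring.jacobson (integralClosure V K) ^ 2,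
      ∃ _ : f.unitSubgroup.Normal,
        IsCyclic (Gal(K/F) ⧸ f.unitSubgroup) ∧
        (f.unitSubgroup = ⊤ ∨
          ∃ σ : Gal(K/F),
            Subgroup.zpowers (σ : Gal(K/F) ⧸ f.unitSubgroup) = ⊤ ∧
            (∀ i < Nat.card (Gal(K/F) ⧸ f.unitSubgroup),
              ∀ j < Nat.card (Gal(K/F) ⧸ f.unitSubgroup),
                ((σ ^ i : Gal(K/F)) : Gal(K/F) ⧸ f.unitSubgroup) ≤
                  ((σ ^ j : Gal(K/F)) : Gal(K/F) ⧸ f.unitSubgroup) ↔ i ≤ j) ∧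
            (Ring.jacobson f.CrossedProduct : Set f.CrossedProduct) =
              Set.range fun a : f.CrossedProduct => NormalizedCocycle.CrossedProduct.x f σ * a)] := by
  have := hindecomposed.valuationRing
  have := isInvariant_integralClosure V F K
  have := htame.isSeparable_quotient
  have hcard : Fintype.card Gal(K/F) =
      ramIndex V F (locAt (maximalIdeal (integralClosure V K))) K *
        Module.finrank (V ⧸ maximalIdeal V)
          (integralClosure V K ⧸ maximalIdeal (integralClosure V K)) := by
    -- S is local, so r = 1 in the defectless formula.
    rw [finrank_quotient_eq, ← Nat.card_eq_fintype_card, IsGalois.card_aut_eq_finrank,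
      hdefectless (maximalIdeal (integralClosure V K)), Nat.card_unique, mul_one]
  obtain ⟨c, hc⟩ := exists_sum_smul_eq_one hcard fun h0 =>
    (htame (maximalIdeal (integralClosure V K))).1 ((ringChar.spec _ _).mp h0)
  rw [IsLocalRing.ringJacobson_eq_maximalIdeal] at hprincipal
  obtain ⟨ϖ, hϖ⟩ := exists_maximalIdeal_eq_span_of_isInvariant (B := integralClosure V K)
    (G := Gal(K/F)) hprincipal
  exact f.tfae_isSemihereditary hc hϖ
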